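/- Let $d\ge 1$ and write $|\cdot|$ for the Lebesgue measure on $\mathbb{R}^d$. For a Lebesgue measurable set $\Omega\subset\mathbb{R}^d$ with $|\Omega|<\infty$ let $$\widetilde H^1_0(\Omega)=\{u\in H^1(\mathbb{R}^d):\ u=0\ \text{a.e. on}\ \mathbb{R}^d\setminus\Omega\},$$ let $w_\Omega\in\widetilde H^1_0(\Omega)$ be the weak solution of $-\Delta w_\Omega=1$, that is, $\int_\Omega\nabla w_\Omega\cdot\nabla v\,dx=\int_\Omega v\,dx$ for every $v\in\widetilde H^1_0(\Omega)$, and let $$\widetilde E(\Omega)=\min_{w\in\widetilde H^1_0(\Omega)}\Big(\tfrac12\int_\Omega|\nabla w|^2\,dx-\int_\Omega w\,dx\Big).$$ Let $P(\Omega)=\sup\{\int_\Omega \operatorname{div}X\,dx:\ X\in C^1_c(\mathbb{R}^d;\mathbb{R}^d),\ |X|\le 1\}\in[0,\infty]$ be the De Giorgi perimeter. A measurable set $\Omega\subset\mathbb{R}^d$ with $|\Omega|<\infty$ and $P(\Omega)<\infty$ is called an energy subsolution if there are constants $\varepsilon>0$ and $k>0$ such that $$\widetilde E(\Omega)+kP(\Omega)\le\widetilde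 E(U)+kP(U)$$ for every measurable $U\subset\Omega$ with $\|w_\Omega-w_U\|_{L^2(\mathbb{R}^d)}\le\varepsilon$. Then every energy subsolution $\Omega\subset\mathbb{R}^d$ is bounded up to a Lebesgue null set: there is $R\in\mathbb{R}$ such that $|\Omega\setminus B_R(0)|=0$. -/

import Mathlib

open MeasureTheory Metric
open scoped ENNReal ContDiff

noncomputable section

/-- The Euclidean space `ℝ^d`. -/
abbrev Euc (d : ℕ) : Type := EuclideanSpace ℝ (Fin d)

/-- `u ∈ H¹(ℝ^d)` with weak gradient `∇u = g`: both are square integrable, and the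
integration by parts formula holds against every test function in every direction. -/
structure IsH1With {d : ℕ} (u : Euc d → ℝ) (g : Euc d → Euc d) : Prop where
  memLp : MemLp u 2 volume
  memLp_grad : MemLp g 2 volume
  integral_by_parts : ∀ φ : Euc d → ℝ, ContDiff ℝ ∞ φ → HasCompactSupport φ → ∀ v : Euc d,
    ∫ x, u x * fderiv ℝ φ x v = - ∫ x, inner ℝ (g x) v * φ x

/-- `u` belongs to the Sobolev-like space `{u ∈ H¹(ℝ^d) : u = 0 a.e. on Ωᶜ}`, with `∇u = g`. -/
structure IsSobolevLike {d : ℕ} (Ω : Set (Euc d)) (u : Euc d → ℝ) (g : Euc d → Euc d) : Prop where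
  isH1 : IsH1With u g
  ae_eq_zero : ∀ᵐ x, x ∉ Ω → u x = 0

/-- `w = w_Ω` is the weak solution, in the Sobolev-like space of `Ω`, of `-Δ w = 1`
(unique up to a.e. equality when `Ω` has finite measure). -/
def IsTorsionFunction {d : ℕ} (Ω : Set (Euc d)) (w : Euc d → ℝ) : Prop :=
  ∃ g : Euc d → Euc d, IsSobolevLike Ω w g ∧
    ∀ (v : Euc d → ℝ) (h : Euc d → Euc d), IsSobolevLike Ω v h →
      ∫ x in Ω, inner ℝ (g x) (h x) = ∫ x in Ω, v x

/-- The functional `J(w) = ½ ∫_Ω |∇w|² - ∫_Ω w`, where `g = ∇w`. -/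
def torsionFunctional {d : ℕ} (Ω : Set (Euc d)) (w : Euc d → ℝ) (g : Euc d → Euc d) : ℝ :=
  (1 / 2) * (∫ x in Ω, ‖g x‖ ^ 2) - ∫ x in Ω, w x

/-- The energy of `Ω`: the minimum of `J` over the Sobolev-like space of `Ω`. -/
def energy {d : ℕ} (Ω : Set (Euc d)) : ℝ :=
  sInf {e : ℝ | ∃ (w : Euc d → ℝ) (g : Euc d → Euc d),
    IsSobolevLike Ω w g ∧ e = torsionFunctional Ω w g}

/-- The divergence of a vector field. -/
def divergence {d : ℕ} (X : Euc d → Euc d) (x : Euc d) : ℝ :=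
  ∑ i : Fin d, (fderiv ℝ X x (EuclideanSpace.single i 1)) i

/-- The (De Giorgi) perimeter of `Ω`: the supremum of `∫_Ω div X` over all compactly supported
`C¹` vector fields `X` with `|X| ≤ 1`. The supremum is nonnegative, since `X = 0` is admissible. -/
def perimeter {d : ℕ} (Ω : Set (Euc d)) : ℝ≥0∞ :=
  ⨆ (X : Euc d → Euc d) (_ : ContDiff ℝ 1 X) (_ : HasCompactSupport X) (_ : ∀ x, ‖X x‖ ≤ 1),
    ENNReal.ofReal (∫ x in Ω, divergence X x)

/-- Local energy subsolutions with respect to the perimeter. `NullMeasurableSet` is Lebesgue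
measurability. The inequality `E(Ω) + k P(Ω) ≤ E(U) + k P(U)` is void when `P(U) = ∞`, so it is
only required (as an inequality of real numbers) for `P(U) < ∞`. -/
structure IsEnergySubsolution {d : ℕ} (Ω : Set (Euc d)) : Prop where
  measurable : NullMeasurableSet Ω volume
  finite_volume : volume Ω < ⊤
  finite_perimeter : perimeter Ω < ⊤
  subsolution : ∃ ε : ℝ, 0 < ε ∧ ∃ k : ℝ, 0 < k ∧
    ∀ U : Set (Euc d), U ⊆ Ω → NullMeasurableSet U volume →
      ∀ wΩ wU : Euc d → ℝ, IsTorsionFunction Ω wΩ → IsTorsionFunction U wU →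
        eLpNorm (fun x => wΩ x - wU x) 2 volume ≤ ENNReal.ofReal ε →
        perimeter U < ⊤ →
        energy Ω + k * (perimeter Ω).toReal ≤ energy U + k * (perimeter U).toReal

end

/-! Let `w` be the torsion function of `Ω`. For a unit vector `e`, let `Y t` be the integral of
`1 + w²` over the part of `Ω` beyond the hyperplane `⟪e, x⟫ = t`. Removing from `Ω` the part
beyond a later hyperplane `⟪e, x⟫ = s`, with `s ≥ t + δ`, leaves a set `U` whose energy exceeds that
of `Ω` by at most `C δ⁻² Y t`: this is Caccioppoli's inequality, with the competitor `(1 - η) w`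
for a cutoff function `η`. The energy difference also bounds `‖w - w_U‖²`, so `U` is admissible for
large `t`, and the subsolution property gives `P(Ω) - P(U) ≤ C δ⁻² Y t`.

A suitable choice of `s` in an interval of length `δ` makes the slope of the volume beyond `s` at
most its average, and then `P(U) + P(Ω \ U) ≤ P(Ω) + C δ⁻¹ Y t`. Hence `P(Ω \ U) ≤ C δ⁻² Y t`. On
sets of volume at most `|B_r| / 2` the isoperimetric and the Poincaré inequality hold with
constants proportional to `r` and `r²`, which yields `Y (t + 2δ) ≤ C r δ⁻² Y t` as soon as
`2 Y t ≤ |B_r|`. Iterating with geometric sequences of `δ` and `r` shows that `Y` vanishes at a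
finite level.

Both inequalities come from one averaging argument: if `2|A| ≤ |B_r|`, some translate of `A` by a
vector shorter than `r` covers at most half of `A`. -/

section Hilbert

variable {H : Type*} [NormedAddCommGroup H] [InnerProductSpace ℝ H]

lemma norm_le_of_dense_of_abs_inner_le {s : Set H} (hs : Dense s) {x : H} {M : ℝ} (hM : 0 ≤ M)
    (h : ∀ y ∈ s, |inner ℝ x y| ≤ M * ‖y‖) : ‖x‖ ≤ M := by
  have hclosed : IsClosed {y | |inner ℝ x y| ≤ M * ‖y‖} := isClosed_le (by fun_prop) (by fun_prop)
  have hx : |inner ℝ x x| ≤ M * ‖x‖ := closure_minimal h hclosed (hs x)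
  rw [real_inner_self_eq_norm_sq, abs_of_nonneg (by positivity)] at hx
  rcases (norm_nonneg x).eq_or_lt with h0 | h0
  · rwa [← h0]
  · nlinarith

lemma tendsto_inner_of_dense {ι : Type*} {l : Filter ι} {s : Set H} (hs : Dense s) {x : ι → H}
    {x₀ : H} {C : ℝ} (hC : ∀ i, ‖x i‖ ≤ C)
    (h : ∀ y ∈ s, Filter.Tendsto (fun i => inner ℝ (x i) y) l (nhds (inner ℝ x₀ y))) (y : H) :
    Filter.Tendsto (fun i => inner ℝ (x i) y) l (nhds (inner ℝ x₀ y)) := by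
  have hequi : UniformEquicontinuous fun i y => inner ℝ (x i) y := by
    refine LipschitzWith.uniformEquicontinuous _ C.toNNReal fun i =>
      LipschitzWith.of_dist_le_mul fun y z => ?_
    rw [Real.dist_eq, ← inner_sub_right, dist_eq_norm]
    exact (abs_real_inner_le_norm _ _).trans
      (mul_le_mul_of_nonneg_right ((hC i).trans (Real.le_coe_toNNReal C)) (norm_nonneg _))
  exact closure_minimal h (hequi.equicontinuous.isClosed_setOfPred_tendsto (by fun_prop)) (hs y)

end Hilbert

section SquareIntegrable

variable {α : Type*} [MeasurableSpace α] {μ : Measure α}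
  {E : Type*} [NormedAddCommGroup E] [InnerProductSpace ℝ E]

lemma integrable_inner_of_memLp {f g : α → E} (hf : MemLp f 2 μ) (hg : MemLp g 2 μ) :
    Integrable (fun x => inner ℝ (f x) (g x)) μ := by
  refine (L2.integrable_inner (𝕜 := ℝ) (hf.toLp f) (hg.toLp g)).congr ?_
  filter_upwards [hf.coeFn_toLp, hg.coeFn_toLp] with x hfx hgx
  rw [hfx, hgx]

lemma integrable_norm_sq_of_memLp {f : α → E} (hf : MemLp f 2 μ) :
    Integrable (fun x => ‖f x‖ ^ 2) μ := by
  simpa using integrable_inner_of_memLp hf hf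

lemma inner_toLp_toLp {f g : α → E} (hf : MemLp f 2 μ) (hg : MemLp g 2 μ) :
    inner ℝ (hf.toLp f) (hg.toLp g) = ∫ x, inner ℝ (f x) (g x) ∂μ := by
  rw [L2.inner_def]
  refine integral_congr_ae ?_
  filter_upwards [hf.coeFn_toLp, hg.coeFn_toLp] with x hfx hgx
  rw [hfx, hgx]

lemma inner_toLp_toLp_eq_integral_mul {f g : α → ℝ} (hf : MemLp f 2 μ) (hg : MemLp g 2 μ) :
    inner ℝ (hf.toLp f) (hg.toLp g) = ∫ x, f x * g x ∂μ := by
  simpa only [Real.inner_apply] using inner_toLp_toLp hf hg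

lemma norm_toLp_sq {f : α → E} (hf : MemLp f 2 μ) :
    ‖hf.toLp f‖ ^ 2 = ∫ x, ‖f x‖ ^ 2 ∂μ := by
  simpa using inner_toLp_toLp hf hf

lemma norm_toLp_eq_sqrt {f : α → E} (hf : MemLp f 2 μ) :
    ‖hf.toLp f‖ = √(∫ x, ‖f x‖ ^ 2 ∂μ) := by
  rw [← norm_toLp_sq hf, Real.sqrt_sq (norm_nonneg _)]

lemma norm_toLp_eq_sqrt_integral_sq {f : α → ℝ} (hf : MemLp f 2 μ) :
    ‖hf.toLp f‖ = √(∫ x, f x ^ 2 ∂μ) := by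
  simpa only [Real.norm_eq_abs, sq_abs] using norm_toLp_eq_sqrt hf

lemma abs_integral_inner_le {f g : α → E} (hf : MemLp f 2 μ) (hg : MemLp g 2 μ) :
    |∫ x, inner ℝ (f x) (g x) ∂μ| ≤ √(∫ x, ‖f x‖ ^ 2 ∂μ) * √(∫ x, ‖g x‖ ^ 2 ∂μ) := by
  rw [← inner_toLp_toLp hf hg, ← norm_toLp_eq_sqrt hf, ← norm_toLp_eq_sqrt hg]
  exact abs_real_inner_le_norm _ _

lemma abs_integral_mul_le {f g : α → ℝ} (hf : MemLp f 2 μ) (hg : MemLp g 2 μ) :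
    |∫ x, f x * g x ∂μ| ≤ √(∫ x, f x ^ 2 ∂μ) * √(∫ x, g x ^ 2 ∂μ) := by
  rw [← inner_toLp_toLp_eq_integral_mul hf hg, ← norm_toLp_eq_sqrt_integral_sq hf,
    ← norm_toLp_eq_sqrt_integral_sq hg]
  exact abs_real_inner_le_norm _ _

lemma eLpNorm_two_le_of_integral_sq_le {f : α → ℝ} (hf : MemLp f 2 μ) {ε : ℝ} (hε : 0 ≤ ε)
    (h : ∫ x, f x ^ 2 ∂μ ≤ ε ^ 2) : eLpNorm f 2 μ ≤ ENNReal.ofReal ε := by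
  rw [← ENNReal.ofReal_toReal hf.eLpNorm_ne_top, ← Lp.norm_toLp f hf,
    norm_toLp_eq_sqrt_integral_sq]
  exact ENNReal.ofReal_le_ofReal (Real.sqrt_le_iff.2 ⟨hε, h⟩)

variable {F : Type*} [NormedAddCommGroup F]

lemma integrable_of_memLp_two_of_ae_eq_zero {A : Set α} (hA : μ A < ⊤) {u : α → F}
    (hu : MemLp u 2 μ) (h0 : ∀ᵐ x ∂μ, x ∉ A → u x = 0) : Integrable u μ := by
  have : IsFiniteMeasure (μ.restrict A) := ⟨by simpa using hA⟩
  have hA : IntegrableOn u A μ := (hu.restrict A).integrable one_le_two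
  exact hA.integrable_of_ae_notMem_eq_zero h0

lemma sq_integral_abs_le {A : Set α} (hA : μ A < ⊤) {u : α → ℝ} (hu : MemLp u 2 μ)
    (h0 : ∀ᵐ x ∂μ, x ∉ A → u x = 0) :
    (∫ x, |u x| ∂μ) ^ 2 ≤ μ.real A * ∫ x, u x ^ 2 ∂μ := by
  have : IsFiniteMeasure (μ.restrict A) := ⟨by simpa using hA⟩
  have habs : ∫ x in A, |u x| ∂μ = ∫ x, |u x| ∂μ := by
    refine setIntegral_eq_integral_of_ae_compl_eq_zero ?_
    filter_upwards [h0] with x hx hxA using by rw [hx hxA, abs_zero]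
  have hsq : ∫ x in A, u x ^ 2 ∂μ = ∫ x, u x ^ 2 ∂μ := by
    refine setIntegral_eq_integral_of_ae_compl_eq_zero ?_
    filter_upwards [h0] with x hx hxA using by rw [hx hxA, zero_pow two_ne_zero]
  have hcs := abs_integral_mul_le (memLp_const (1 : ℝ)) (g := fun x => |u x|) (hu.restrict A).abs
  simp only [one_mul, one_pow, sq_abs, habs, hsq, integral_const, smul_eq_mul, mul_one,
    measureReal_restrict_apply_univ] at hcs
  calc (∫ x, |u x| ∂μ) ^ 2 ≤ (√(μ.real A) * √(∫ x, u x ^ 2 ∂μ)) ^ 2 :=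
        pow_le_pow_left₀ (integral_nonneg fun _ => abs_nonneg _) ((le_abs_self _).trans hcs) 2
    _ = μ.real A * ∫ x, u x ^ 2 ∂μ := by
        rw [mul_pow, Real.sq_sqrt (by positivity), Real.sq_sqrt (by positivity)]

end SquareIntegrable

section TestFunctions

variable {E : Type*} [NormedAddCommGroup E] [NormedSpace ℝ E] [FiniteDimensional ℝ E]
  [MeasurableSpace E] [BorelSpace E] {μ : Measure E} [IsFiniteMeasureOnCompacts μ]

lemma sqrt_integral_sq_le_of_test {f : E → ℝ} (hf : MemLp f 2 μ) {M : ℝ} (hM : 0 ≤ M)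
    (h : ∀ φ : E → ℝ, ContDiff ℝ ∞ φ → HasCompactSupport φ →
      |∫ x, f x * φ x ∂μ| ≤ M * √(∫ x, φ x ^ 2 ∂μ)) :
    √(∫ x, f x ^ 2 ∂μ) ≤ M := by
  rw [← norm_toLp_eq_sqrt_integral_sq hf]
  refine norm_le_of_dense_of_abs_inner_le
    (Lp.dense_hasCompactSupport_contDiff (F := ℝ) (p := 2) (μ := μ) ENNReal.ofNat_ne_top) hM ?_
  rintro p ⟨φ, hpφ, hc, hφ⟩
  have hφ2 : MemLp φ 2 μ := hφ.continuous.memLp_of_hasCompactSupport hc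
  obtain rfl : p = hφ2.toLp φ := Lp.ext (hpφ.trans hφ2.coeFn_toLp.symm)
  rw [inner_toLp_toLp_eq_integral_mul, norm_toLp_eq_sqrt_integral_sq]
  exact h φ hφ hc

lemma tendsto_integral_mul_of_test {ι : Type*} {l : Filter ι} {f : ι → E → ℝ} {f₀ : E → ℝ}
    (hf : ∀ i, MemLp (f i) 2 μ) (hf₀ : MemLp f₀ 2 μ) {C : ℝ}
    (hC : ∀ i, √(∫ x, f i x ^ 2 ∂μ) ≤ C)
    (h : ∀ φ : E → ℝ, ContDiff ℝ ∞ φ → HasCompactSupport φ →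
      Filter.Tendsto (fun i => ∫ x, f i x * φ x ∂μ) l (nhds (∫ x, f₀ x * φ x ∂μ)))
    {ψ : E → ℝ} (hψ : MemLp ψ 2 μ) :
    Filter.Tendsto (fun i => ∫ x, f i x * ψ x ∂μ) l (nhds (∫ x, f₀ x * ψ x ∂μ)) := by
  simp only [← inner_toLp_toLp_eq_integral_mul (hf _) hψ, ← inner_toLp_toLp_eq_integral_mul hf₀ hψ]
  refine tendsto_inner_of_dense
    (Lp.dense_hasCompactSupport_contDiff (F := ℝ) (p := 2) (μ := μ) ENNReal.ofNat_ne_top)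
    (fun i => (norm_toLp_eq_sqrt_integral_sq (hf i)).trans_le (hC i)) ?_ (hψ.toLp ψ)
  rintro p ⟨φ, hpφ, hc, hφ⟩
  have hφ2 : MemLp φ 2 μ := hφ.continuous.memLp_of_hasCompactSupport hc
  obtain rfl : p = hφ2.toLp φ := Lp.ext (hpφ.trans hφ2.coeFn_toLp.symm)
  simpa only [inner_toLp_toLp_eq_integral_mul] using h φ hφ hc

end TestFunctions

section Translation

variable {E : Type*} [NormedAddCommGroup E]

lemma hasCompactSupport_comp_sub {φ : E → ℝ} (hφ : HasCompactSupport φ) (y : E) :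
    HasCompactSupport (fun x => φ (x - y)) :=
  hφ.comp_homeomorph (Homeomorph.subRight y)

lemma contDiff_comp_sub [NormedSpace ℝ E] {n : WithTop ℕ∞} {φ : E → ℝ} (hφ : ContDiff ℝ n φ)
    (y : E) : ContDiff ℝ n (fun x => φ (x - y)) :=
  hφ.comp (contDiff_id.sub contDiff_const)

variable [MeasurableSpace E] [BorelSpace E] {μ : Measure E}

lemma memLp_translate [μ.IsAddRightInvariant] {F : Type*} [NormedAddCommGroup F] {f : E → F}
    {p : ℝ≥0∞} (hf : MemLp f p μ) (y : E) : MemLp (fun x => f (x + y)) p μ :=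
  hf.comp_measurePreserving (measurePreserving_add_right μ y)

lemma integral_translate_sub_mul [μ.IsAddRightInvariant] {u φ : E → ℝ} (hu : MemLp u 2 μ)
    (hφ : MemLp φ 2 μ) (y : E) :
    ∫ x, (u (x + y) - u x) * φ x ∂μ = (∫ x, u x * φ (x - y) ∂μ) - ∫ x, u x * φ x ∂μ := by
  have huy : Integrable (fun x => u (x + y) * φ x) μ := (memLp_translate hu y).integrable_mul hφ
  have hu0 : Integrable (fun x => u x * φ x) μ := hu.integrable_mul hφ
  simp only [sub_mul]
  rw [integral_sub huy hu0, ← integral_sub_right_eq_self (fun x => u (x + y) * φ x) y]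
  simp only [sub_add_cancel]

lemma integral_translate_sub_sq [μ.IsAddRightInvariant] {u : E → ℝ} (hu : MemLp u 2 μ) (y : E) :
    ∫ x, (u (x + y) - u x) ^ 2 ∂μ = 2 * (∫ x, u x ^ 2 ∂μ) - 2 * ∫ x, u x * u (x + y) ∂μ := by
  have huy := memLp_translate hu y
  have hmul : Integrable (fun x => u x * u (x + y)) μ := hu.integrable_mul huy
  have hsub : Integrable (fun x => u x ^ 2 - 2 * (u x * u (x + y))) μ :=
    hu.integrable_sq.sub (hmul.const_mul 2)
  have hexpand : ∀ x, (u (x + y) - u x) ^ 2 = u (x + y) ^ 2 + (u x ^ 2 - 2 * (u x * u (x + y))) :=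
    fun x => by ring
  simp only [hexpand]
  rw [integral_add huy.integrable_sq hsub, integral_sub hu.integrable_sq (hmul.const_mul 2),
    integral_const_mul, integral_add_right_eq_self (fun x => u x ^ 2) y]
  ring

lemma tendsto_measure_symmDiff_preimage_add_right [μ.IsAddRightInvariant] [ProperSpace E]
    [IsFiniteMeasureOnCompacts μ] {A : Set E} (hA : NullMeasurableSet A μ) (hA' : μ A < ⊤) :
    Filter.Tendsto (fun z => μ (symmDiff ((fun x => x + z) ⁻¹' A) A)) (nhds 0) (nhds 0) := by
  have hcont : Continuous fun z : E => (⟨fun x => x + z, by fun_prop⟩ : C(E, E)) :=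
    ContinuousMap.continuous_of_continuous_uncurry _
      (continuous_snd.add continuous_fst)
  simpa using tendsto_measure_symmDiff_preimage_nhds_zero (hcont.tendsto 0)
    (Filter.Eventually.of_forall fun z => measurePreserving_add_right μ z)
    (measurePreserving_add_right μ 0) hA hA'.ne

variable [NormedSpace ℝ E] [FiniteDimensional ℝ E] [μ.IsAddHaarMeasure]

lemma hasDerivAt_integral_mul_translate {f φ : E → ℝ} (hf : LocallyIntegrable f μ)
    (hφ : ContDiff ℝ 1 φ) (hc : HasCompactSupport φ) (y : E) (s : ℝ) :
    HasDerivAt (fun s : ℝ => ∫ x, f x * φ (x - s • y) ∂μ)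
      (-(∫ x, f x * fderiv ℝ φ (x - s • y) y ∂μ)) s := by
  set ψ : E → ℝ := fun x => φ (-x) with hψ_def
  have hψ : ContDiff ℝ 1 ψ := hφ.comp contDiff_neg
  have hψc : HasCompactSupport ψ := hc.comp_homeomorph (Homeomorph.neg E)
  have hψ_fderiv : ∀ z, fderiv ℝ ψ z y = - fderiv ℝ φ (-z) y := fun z => by
    simpa only [neg_smul, one_smul, neg_apply] using
      congr($(fderiv_comp_smul (f := φ) (x := z) (-1 : ℝ)) y)
  have hline : HasDerivAt (fun s : ℝ => s • y) y s := by
    simpa using (hasDerivAt_id s).smul_const y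
  have hconv := (hψc.hasFDerivAt_convolution_right (μ := μ) (ContinuousLinearMap.mul ℝ ℝ) hf hψ
    (s • y)).comp_hasDerivAt s hline
  rw [convolution_precompR_apply _ hf (hψc.fderiv ℝ) (hψ.continuous_fderiv one_ne_zero)] at hconv
  refine (hconv.congr_deriv ?_).congr_of_eventuallyEq (Filter.Eventually.of_forall fun s => ?_)
  · simp only [convolution, ContinuousLinearMap.mul_apply', hψ_fderiv, neg_sub, mul_neg,
      integral_neg]
  · simp only [Function.comp, convolution, ContinuousLinearMap.mul_apply', hψ_def, neg_sub]

lemma abs_integral_mul_translate_sub_le {f φ : E → ℝ} (hf : LocallyIntegrable f μ)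
    (hφ : ContDiff ℝ 1 φ) (hc : HasCompactSupport φ) (y : E) {C : ℝ}
    (hC : ∀ z, |∫ x, f x * fderiv ℝ φ (x - z) y ∂μ| ≤ C) :
    |(∫ x, f x * φ (x - y) ∂μ) - ∫ x, f x * φ x ∂μ| ≤ C := by
  have hmv := norm_image_sub_le_of_norm_deriv_le_segment_01' (C := C)
    (fun s _ => (hasDerivAt_integral_mul_translate hf hφ hc y s).hasDerivWithinAt)
    (fun s _ => by rw [norm_neg]; exact hC _)
  simpa only [one_smul, zero_smul, sub_zero, Real.norm_eq_abs] using hmv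

lemma exists_mem_ball_integral_abs_mul_translate_le {u : E → ℝ} (hu : Integrable u μ) {r : ℝ}
    (hr : 0 < r) :
    ∃ y ∈ ball (0 : E) r, (∫ x, |u x| * |u (x + y)| ∂μ) * μ.real (ball (0 : E) r) ≤
      (∫ x, |u x| ∂μ) ^ 2 := by
  have hneg : Integrable (fun x => |u (-x)|) μ := hu.abs.comp_neg
  set overlap : E → ℝ := fun y => ∫ x, |u x| * |u (x + y)| ∂μ with h_overlap
  have hconv : convolution (fun x => |u (-x)|) (fun x => |u x|) (ContinuousLinearMap.mul ℝ ℝ) μ =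
      overlap := by
    ext y
    simp only [convolution, ContinuousLinearMap.mul_apply', h_overlap]
    rw [← integral_neg_eq_self]
    simp only [neg_neg, sub_neg_eq_add, add_comm]
  have hint : Integrable overlap μ :=
    hconv ▸ hneg.integrable_convolution (ContinuousLinearMap.mul ℝ ℝ) hu.abs
  have hfubini : ∫ y, overlap y ∂μ = (∫ x, |u x| ∂μ) ^ 2 := by
    rw [← hconv, integral_convolution _ hneg hu.abs, integral_neg_eq_self (fun x => |u x|),
      ContinuousLinearMap.mul_apply', sq]
  have hB0 : μ (ball (0 : E) r) ≠ 0 := (measure_ball_pos _ _ hr).ne'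
  have hB1 : μ (ball (0 : E) r) ≠ ⊤ := measure_ball_lt_top.ne
  obtain ⟨y, hy, hle⟩ := exists_le_setAverage hB0 hB1 hint.integrableOn
  have hpos : 0 < μ.real (ball (0 : E) r) := ENNReal.toReal_pos hB0 hB1
  refine ⟨y, hy, ?_⟩
  rw [setAverage_eq, smul_eq_mul, inv_mul_eq_div, le_div_iff₀ hpos] at hle
  refine hle.trans (le_of_le_of_eq ?_ hfubini)
  exact setIntegral_le_integral hint (Filter.Eventually.of_forall fun y => by
    simp only [Pi.zero_apply, h_overlap]; positivity)

lemma exists_mem_ball_integral_abs_mul_translate_le_half {A : Set E} (hA : μ A < ⊤) {u : E → ℝ}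
    (hu : MemLp u 2 μ) (h0 : ∀ᵐ x ∂μ, x ∉ A → u x = 0) {r : ℝ} (hr : 0 < r)
    (hball : 2 * μ.real A ≤ μ.real (ball (0 : E) r)) :
    ∃ y ∈ ball (0 : E) r, ∫ x, |u x| * |u (x + y)| ∂μ ≤ (∫ x, u x ^ 2 ∂μ) / 2 := by
  obtain ⟨y, hy, hle⟩ := exists_mem_ball_integral_abs_mul_translate_le
    (integrable_of_memLp_two_of_ae_eq_zero hA hu h0) hr
  have hB : 0 < μ.real (ball (0 : E) r) :=
    ENNReal.toReal_pos (measure_ball_pos _ _ hr).ne' measure_ball_lt_top.ne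
  have hI : 0 ≤ ∫ x, u x ^ 2 ∂μ := by positivity
  refine ⟨y, hy, le_of_mul_le_mul_right (hle.trans ((sq_integral_abs_le hA hu h0).trans ?_)) hB⟩
  nlinarith

end Translation

section Sobolev

variable {d : ℕ} {u : Euc d → ℝ} {g : Euc d → Euc d}

lemma IsH1With.abs_integral_mul_fderiv_le (h : IsH1With u g) {φ : Euc d → ℝ} (hφ : ContDiff ℝ ∞ φ)
    (hc : HasCompactSupport φ) (y : Euc d) :
    |∫ x, u x * fderiv ℝ φ x y| ≤ ‖y‖ * √(∫ x, ‖g x‖ ^ 2) * √(∫ x, φ x ^ 2) := by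
  have hφy : MemLp (fun x => φ x • y) 2 volume :=
    (hφ.continuous.smul continuous_const).memLp_of_hasCompactSupport hc.smul_right
  have hcs := abs_integral_inner_le h.memLp_grad hφy
  simp only [inner_smul_right, norm_smul, mul_pow, Real.norm_eq_abs, sq_abs] at hcs
  rw [integral_mul_const, Real.sqrt_mul' _ (by positivity), Real.sqrt_sq (norm_nonneg _)] at hcs
  rw [h.integral_by_parts φ hφ hc y, abs_neg, mul_rotate]
  simpa only [mul_comm (inner ℝ (g _) y), mul_assoc, mul_comm ‖y‖] using hcs

lemma IsH1With.sqrt_integral_translate_sub_sq_le (h : IsH1With u g) (y : Euc d) :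
    √(∫ x, (u (x + y) - u x) ^ 2) ≤ ‖y‖ * √(∫ x, ‖g x‖ ^ 2) := by
  refine sqrt_integral_sq_le_of_test ((memLp_translate h.memLp y).sub h.memLp) (by positivity)
    fun φ hφ hc => ?_
  simp only [Pi.sub_apply]
  rw [integral_translate_sub_mul h.memLp (hφ.continuous.memLp_of_hasCompactSupport hc)]
  refine abs_integral_mul_translate_sub_le (h.memLp.locallyIntegrable one_le_two)
    (hφ.of_le (by exact_mod_cast le_top)) hc y fun z => ?_
  have hz := h.abs_integral_mul_fderiv_le (contDiff_comp_sub hφ z)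
    (hasCompactSupport_comp_sub hc z) y
  simp only [fderiv_comp_sub] at hz
  rwa [integral_sub_right_eq_self (fun x => φ x ^ 2)] at hz

lemma IsSobolevLike.integral_sq_le {A : Set (Euc d)} (hA : volume A < ⊤)
    (h : IsSobolevLike A u g) {r : ℝ} (hr : 0 < r)
    (hball : 2 * volume.real A ≤ volume.real (ball (0 : Euc d) r)) :
    ∫ x, u x ^ 2 ≤ r ^ 2 * ∫ x, ‖g x‖ ^ 2 := by
  have hu := h.isH1.memLp
  obtain ⟨y, hy, hhalf⟩ :=
    exists_mem_ball_integral_abs_mul_translate_le_half hA hu h.ae_eq_zero hr hball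
  have huy := memLp_translate hu y
  have hoverlap : ∫ x, u x * u (x + y) ≤ ∫ x, |u x| * |u (x + y)| :=
    integral_mono (hu.integrable_mul huy) (hu.abs.integrable_mul huy.abs) fun x => by
      simpa only [← abs_mul] using le_abs_self (u x * u (x + y))
  have hquot : ∫ x, (u (x + y) - u x) ^ 2 ≤ (‖y‖ * √(∫ x, ‖g x‖ ^ 2)) ^ 2 :=
    (Real.sqrt_le_iff.1 (h.isH1.sqrt_integral_translate_sub_sq_le y)).2
  calc ∫ x, u x ^ 2 ≤ ∫ x, (u (x + y) - u x) ^ 2 := by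
        rw [integral_translate_sub_sq hu]; linarith
    _ ≤ ‖y‖ ^ 2 * ∫ x, ‖g x‖ ^ 2 := by rwa [mul_pow, Real.sq_sqrt (by positivity)] at hquot
    _ ≤ r ^ 2 * ∫ x, ‖g x‖ ^ 2 := by
        have hyr : ‖y‖ ≤ r := (mem_ball_zero_iff.1 hy).le
        gcongr

lemma IsH1With.hasDerivAt_integral_translate_sub_mul (h : IsH1With u g) {φ : Euc d → ℝ}
    (hφ : ContDiff ℝ ∞ φ) (hc : HasCompactSupport φ) (y : Euc d) :
    HasDerivAt (fun s : ℝ => ∫ x, (u (x + s • y) - u x) * φ x) (∫ x, inner ℝ (g x) y * φ x) 0 := by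
  have hderiv := hasDerivAt_integral_mul_translate (h.memLp.locallyIntegrable one_le_two)
    (hφ.of_le (by exact_mod_cast le_top)) hc y 0
  simp only [zero_smul, sub_zero] at hderiv
  rw [h.integral_by_parts φ hφ hc y, neg_neg] at hderiv
  simpa only [integral_translate_sub_mul h.memLp (hφ.continuous.memLp_of_hasCompactSupport hc)]
    using hderiv.sub_const (∫ x, u x * φ x)

lemma IsH1With.tendsto_integral_differenceQuotient_mul (h : IsH1With u g) (y : Euc d)
    {ψ : Euc d → ℝ} (hψ : MemLp ψ 2 volume) :
    Filter.Tendsto (fun s : ℝ => s⁻¹ * ∫ x, (u (x + s • y) - u x) * ψ x) (nhdsWithin 0 {0}ᶜ)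
      (nhds (∫ x, inner ℝ (g x) y * ψ x)) := by
  have hquot : ∀ s : ℝ, MemLp (fun x => s⁻¹ * (u (x + s • y) - u x)) 2 volume := fun s =>
    ((memLp_translate h.memLp (s • y)).sub h.memLp).const_mul s⁻¹
  have hbound : ∀ s : ℝ,
      √(∫ x, (s⁻¹ * (u (x + s • y) - u x)) ^ 2) ≤ ‖y‖ * √(∫ x, ‖g x‖ ^ 2) := fun s => by
    simp only [mul_pow, integral_const_mul]
    rw [Real.sqrt_mul (by positivity), Real.sqrt_sq_eq_abs, abs_inv]
    refine inv_mul_le_of_le_mul₀ (abs_nonneg s) (by positivity) ?_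
    simpa only [norm_smul, Real.norm_eq_abs, mul_assoc] using
      h.sqrt_integral_translate_sub_sq_le (s • y)
  simp only [← integral_const_mul, ← mul_assoc]
  refine tendsto_integral_mul_of_test hquot (h.memLp_grad.inner_const y) hbound
    (fun φ hφ hc => ?_) hψ
  simpa [mul_assoc, integral_const_mul] using
    (h.hasDerivAt_integral_translate_sub_mul hφ hc y).tendsto_slope_zero

lemma IsSobolevLike.abs_integral_translate_sub_mul_le {A : Set (Euc d)} (h : IsSobolevLike A u g)
    {ψ : Euc d → ℝ} (hψ : MemLp ψ 2 volume) (h0 : ∀ x ∈ A, ψ x = 0) (z : Euc d) :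
    |∫ x, (u (x + z) - u x) * ψ x| ≤
      ‖z‖ * √(∫ x, ‖g x‖ ^ 2) * √(∫ x in symmDiff ((fun x => x + z) ⁻¹' A) A, ψ x ^ 2) := by
  set B : Set (Euc d) := symmDiff ((fun x => x + z) ⁻¹' A) A
  have hdiff : MemLp (fun x => u (x + z) - u x) 2 volume :=
    (memLp_translate h.isH1.memLp z).sub h.isH1.memLp
  have hsupport : ∀ᵐ x, x ∉ B → (u (x + z) - u x) * ψ x = 0 := by
    filter_upwards [h.ae_eq_zero,
      (measurePreserving_add_right volume z).quasiMeasurePreserving.ae h.ae_eq_zero]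
      with x hx hxz hxB
    by_cases hxA : x ∈ A
    · rw [h0 x hxA, mul_zero]
    · rw [hx hxA, hxz fun hxzA => hxB (Or.inl ⟨hxzA, hxA⟩), sub_zero, zero_mul]
  rw [← setIntegral_eq_integral_of_ae_compl_eq_zero hsupport]
  refine (abs_integral_mul_le (hdiff.restrict B) (hψ.restrict B)).trans ?_
  refine mul_le_mul_of_nonneg_right (le_trans ?_ (h.isH1.sqrt_integral_translate_sub_sq_le z))
    (Real.sqrt_nonneg _)
  exact Real.sqrt_le_sqrt (setIntegral_le_integral hdiff.integrable_sq
    (Filter.Eventually.of_forall fun x => sq_nonneg _))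

/-- The difference quotients `D_s u` are carried by the union of `A` and a translate of `A`, so
their mass against a function vanishing on `A` tends to zero. -/
lemma IsSobolevLike.integral_inner_mul_eq_zero {A : Set (Euc d)} (hA : NullMeasurableSet A volume)
    (hA' : volume A < ⊤) (h : IsSobolevLike A u g) (y : Euc d) {ψ : Euc d → ℝ}
    (hψ : MemLp ψ 2 volume) (h0 : ∀ x ∈ A, ψ x = 0) : ∫ x, inner ℝ (g x) y * ψ x = 0 := by
  set B : ℝ → Set (Euc d) := fun s => symmDiff ((fun x => x + s • y) ⁻¹' A) A
  have hline : Filter.Tendsto (fun s : ℝ => s • y) (nhdsWithin 0 {0}ᶜ) (nhds 0) := by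
    have hcont : Continuous fun s : ℝ => s • y := by fun_prop
    simpa using (hcont.tendsto 0).mono_left nhdsWithin_le_nhds
  have hmass : Filter.Tendsto (fun s => ‖y‖ * √(∫ x, ‖g x‖ ^ 2) * √(∫ x in B s, ψ x ^ 2))
      (nhdsWithin 0 {0}ᶜ) (nhds 0) := by
    have hB := hψ.integrable_sq.tendsto_setIntegral_nhds_zero
      ((tendsto_measure_symmDiff_preimage_add_right hA hA').comp hline)
    simpa using hB.sqrt.const_mul (‖y‖ * √(∫ x, ‖g x‖ ^ 2))
  refine tendsto_nhds_unique (h.isH1.tendsto_integral_differenceQuotient_mul y hψ)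
    (squeeze_zero_norm' ?_ hmass)
  filter_upwards [self_mem_nhdsWithin] with s hs
  rw [Real.norm_eq_abs, abs_mul, abs_inv, inv_mul_le_iff₀ (abs_pos.2 hs)]
  simpa only [norm_smul, Real.norm_eq_abs, mul_assoc] using
    h.abs_integral_translate_sub_mul_le hψ h0 (s • y)

lemma IsSobolevLike.grad_ae_eq_zero {A : Set (Euc d)} (hA : NullMeasurableSet A volume)
    (hA' : volume A < ⊤) (h : IsSobolevLike A u g) : ∀ᵐ x, x ∉ A → g x = 0 := by
  have hcoord : ∀ y : Euc d, ∀ᵐ x, x ∉ A → inner ℝ (g x) y = 0 := fun y => by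
    set ψ : Euc d → ℝ := Aᶜ.indicator fun x => inner ℝ (g x) y with hψ_def
    have hgy : MemLp (fun x => inner ℝ (g x) y) 2 volume := h.isH1.memLp_grad.inner_const y
    have hψ : MemLp ψ 2 volume := hgy.of_le (hgy.1.indicator₀ hA.compl)
      (Filter.Eventually.of_forall fun x => norm_indicator_le_norm_self _ _)
    have hsq : ∫ x, ψ x ^ 2 = 0 := by
      rw [← h.integral_inner_mul_eq_zero hA hA' y hψ fun x hx => Set.indicator_of_notMem
        (Set.notMem_compl_iff.2 hx) _]
      refine integral_congr_ae (Filter.Eventually.of_forall fun x => ?_)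
      by_cases hx : x ∈ A <;> simp [hψ_def, hx, sq]
    rw [integral_eq_zero_iff_of_nonneg (fun x => sq_nonneg _) hψ.integrable_sq] at hsq
    filter_upwards [hsq] with x hx hxA
    simpa [hψ_def, hxA] using hx
  filter_upwards [ae_all_iff.2 fun i => hcoord (EuclideanSpace.single i 1)] with x hx hxA
  ext i
  simpa [EuclideanSpace.inner_single_right] using hx i hxA

end Sobolev

section SmoothTransition

lemma exists_abs_deriv_smoothTransition_le : ∃ L : ℝ, ∀ x, |deriv Real.smoothTransition x| ≤ L := by
  have hcont : Continuous (deriv Real.smoothTransition) :=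
    (Real.smoothTransition.contDiff (n := 1)).continuous_deriv le_rfl
  refine hcont.bounded_above_of_compact_support (HasCompactSupport.intro isCompact_Icc
    (K := Set.Icc 0 1) fun x hx => ?_)
  rcases not_and_or.1 hx with hx | hx
  · refine IsLocalMin.deriv_eq_zero (Filter.Eventually.of_forall fun y => ?_)
    rw [Real.smoothTransition.zero_of_nonpos (not_le.1 hx).le]
    exact Real.smoothTransition.nonneg y
  · refine IsLocalMax.deriv_eq_zero (Filter.Eventually.of_forall fun y => ?_)
    rw [Real.smoothTransition.one_of_one_le (not_le.1 hx).le]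
    exact Real.smoothTransition.le_one y

/-- A bound for the derivative of the transition function `Real.smoothTransition`; it enters the
gradient bound of the cutoff functions. -/
noncomputable def transitionBound : ℝ := exists_abs_deriv_smoothTransition_le.choose

lemma abs_deriv_smoothTransition_le (x : ℝ) :
    |deriv Real.smoothTransition x| ≤ transitionBound :=
  exists_abs_deriv_smoothTransition_le.choose_spec x

lemma transitionBound_nonneg : 0 ≤ transitionBound :=
  (abs_nonneg _).trans (abs_deriv_smoothTransition_le 0)

lemma abs_smoothTransition_sub_le (a b : ℝ) :
    |Real.smoothTransition a - Real.smoothTransition b| ≤ transitionBound * |a - b| :=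
  convex_univ.norm_image_sub_le_of_norm_deriv_le
    (fun x _ => (Real.smoothTransition.contDiff (n := 1)).differentiable one_ne_zero x)
    (fun x _ => abs_deriv_smoothTransition_le x) (Set.mem_univ b) (Set.mem_univ a)

end SmoothTransition

section Indicator

variable {α : Type*} [MeasurableSpace α] {μ : Measure α} {A : Set α}

lemma integral_indicator_one_mul (hA : NullMeasurableSet A μ) (f : α → ℝ) :
    ∫ x, A.indicator 1 x * f x ∂μ = ∫ x in A, f x ∂μ := by
  rw [← integral_indicator₀ hA]
  congr 1 with x
  by_cases hx : x ∈ A <;> simp [hx]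

lemma memLp_indicator_one (hA : NullMeasurableSet A μ) (hA' : μ A < ⊤) (p : ℝ≥0∞) :
    MemLp (A.indicator (1 : α → ℝ)) p μ := by
  rw [memLp_congr_ae (indicator_ae_eq_of_ae_eq_set hA.toMeasurable_ae_eq).symm]
  refine memLp_indicator_const p (measurableSet_toMeasurable _ _) (1 : ℝ) (Or.inr ?_)
  rwa [measure_toMeasurable, ← lt_top_iff_ne_top]

lemma abs_setIntegral_sub_setIntegral_le {f h : α → ℝ} (hf : Integrable f μ) (hh : Integrable h μ) :
    |(∫ x in A, f x ∂μ) - ∫ x in A, h x ∂μ| ≤ ∫ x, |f x - h x| ∂μ := by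
  rw [← integral_sub hf.integrableOn hh.integrableOn]
  exact abs_integral_le_integral_abs.trans (setIntegral_le_integral (hf.sub hh).abs
    (Filter.Eventually.of_forall fun x => abs_nonneg _))

/-- The transition function fixes `0` and `1`, so composing with it truncates an approximation of
the indicator function without spoiling it. -/
lemma exists_test_integral_abs_indicator_sub_le {E : Type*} [NormedAddCommGroup E]
    [NormedSpace ℝ E] [FiniteDimensional ℝ E] [MeasurableSpace E] [BorelSpace E] {μ : Measure E}
    [IsFiniteMeasureOnCompacts μ] {A : Set E} (hA : NullMeasurableSet A μ) (hA' : μ A < ⊤) {ε : ℝ}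
    (hε : 0 < ε) :
    ∃ φ : E → ℝ, ContDiff ℝ ∞ φ ∧ HasCompactSupport φ ∧ (∀ x, |φ x| ≤ 1) ∧
      ∫ x, |A.indicator 1 x - φ x| ∂μ ≤ ε := by
  have hL : 0 < transitionBound + 1 := by linarith [transitionBound_nonneg]
  obtain ⟨ψ, hc, hψ, hle⟩ := (memLp_indicator_one hA hA' 1).exist_eLpNorm_sub_le
    ENNReal.one_ne_top le_rfl (div_pos hε hL)
  have hψ1 : MemLp ψ 1 μ := hψ.continuous.memLp_of_hasCompactSupport hc
  have hsub : Integrable (fun x => A.indicator 1 x - ψ x) μ :=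
    memLp_one_iff_integrable.1 ((memLp_indicator_one hA hA' 1).sub hψ1)
  have hψ_close : ∫ x, |A.indicator 1 x - ψ x| ∂μ ≤ ε / (transitionBound + 1) := by
    rw [eLpNorm_one_eq_lintegral_enorm] at hle
    exact (integral_norm_eq_lintegral_enorm hsub.1).trans_le
      (ENNReal.toReal_le_of_le_ofReal (by positivity) hle)
  have hfix : ∀ x, Real.smoothTransition (A.indicator 1 x) = A.indicator 1 x := fun x => by
    by_cases hx : x ∈ A <;> simp [hx]
  refine ⟨fun x => Real.smoothTransition (ψ x), Real.smoothTransition.contDiff.comp hψ,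
    hc.comp_left Real.smoothTransition.zero, fun x => ?_, ?_⟩
  · rw [abs_of_nonneg (Real.smoothTransition.nonneg _)]
    exact Real.smoothTransition.le_one _
  calc ∫ x, |A.indicator 1 x - Real.smoothTransition (ψ x)| ∂μ
      ≤ ∫ x, transitionBound * |A.indicator 1 x - ψ x| ∂μ := by
        refine integral_mono_of_nonneg (Filter.Eventually.of_forall fun x => abs_nonneg _)
          (hsub.abs.const_mul _) (Filter.Eventually.of_forall fun x => ?_)
        simpa only [hfix] using abs_smoothTransition_sub_le (A.indicator 1 x) (ψ x)
    _ ≤ transitionBound * (ε / (transitionBound + 1)) := by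
        rw [integral_const_mul]
        exact mul_le_mul_of_nonneg_left hψ_close transitionBound_nonneg
    _ ≤ ε := by
        rw [mul_div_assoc', div_le_iff₀ hL]
        nlinarith

end Indicator

section Perimeter

variable {d : ℕ}

/-- The vector fields admissible in the definition of the perimeter. -/
structure IsPerimeterField (X : Euc d → Euc d) : Prop where
  contDiff : ContDiff ℝ 1 X
  hasCompactSupport : HasCompactSupport X
  norm_le_one : ∀ x, ‖X x‖ ≤ 1

lemma perimeter_eq_iSup (A : Set (Euc d)) :
    perimeter A =
      ⨆ X : {X : Euc d → Euc d // IsPerimeterField X}, ENNReal.ofReal (∫ x in A, divergence X x) :=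
  le_antisymm
    (iSup_le fun X => iSup_le fun hX => iSup_le fun hc => iSup_le fun hX1 =>
      le_iSup_of_le ⟨X, hX, hc, hX1⟩ le_rfl)
    (iSup_le fun X => le_iSup_of_le X.1 (le_iSup_of_le X.2.contDiff
      (le_iSup_of_le X.2.hasCompactSupport (le_iSup_of_le X.2.norm_le_one le_rfl))))

lemma IsPerimeterField.setIntegral_divergence_le {A : Set (Euc d)} {X : Euc d → Euc d}
    (hX : IsPerimeterField X) (hP : perimeter A < ⊤) :
    ∫ x in A, divergence X x ≤ (perimeter A).toReal := by
  refine (ENNReal.ofReal_le_iff_le_toReal hP.ne).1 ?_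
  rw [perimeter_eq_iSup]
  exact le_iSup_of_le ⟨X, hX⟩ le_rfl

lemma divergence_smul_const {φ : Euc d → ℝ} {x : Euc d} (hφ : DifferentiableAt ℝ φ x)
    (y : Euc d) : divergence (fun x => φ x • y) x = fderiv ℝ φ x y := by
  simp only [divergence, fderiv_smul_const hφ, ContinuousLinearMap.smulRight_apply,
    PiLp.smul_apply, smul_eq_mul]
  conv_rhs => rw [← (EuclideanSpace.basisFun (Fin d) ℝ).sum_repr y]
  simp [mul_comm]

lemma setIntegral_fderiv_le {A : Set (Euc d)} (hP : perimeter A < ⊤) {φ : Euc d → ℝ}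
    (hφ : ContDiff ℝ 1 φ) (hc : HasCompactSupport φ) (hφ1 : ∀ x, |φ x| ≤ 1) (y : Euc d) :
    ∫ x in A, fderiv ℝ φ x y ≤ ‖y‖ * (perimeter A).toReal := by
  rcases eq_or_ne y 0 with rfl | hy
  · simp
  have hfield : IsPerimeterField fun x => φ x • (‖y‖⁻¹ • y) :=
    ⟨hφ.smul contDiff_const, hc.smul_right, fun x => by
      rw [norm_smul, norm_smul, norm_inv, norm_norm, inv_mul_cancel₀ (norm_ne_zero_iff.2 hy),
        mul_one]
      exact hφ1 x⟩
  have hdiv := hfield.setIntegral_divergence_le hP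
  simp only [divergence_smul_const (hφ.differentiable one_ne_zero _), map_smul, smul_eq_mul] at hdiv
  rwa [integral_const_mul, inv_mul_le_iff₀ (norm_pos_iff.2 hy)] at hdiv

lemma abs_setIntegral_fderiv_le {A : Set (Euc d)} (hP : perimeter A < ⊤) {φ : Euc d → ℝ}
    (hφ : ContDiff ℝ 1 φ) (hc : HasCompactSupport φ) (hφ1 : ∀ x, |φ x| ≤ 1) (y : Euc d) :
    |∫ x in A, fderiv ℝ φ x y| ≤ ‖y‖ * (perimeter A).toReal := by
  refine abs_le'.2 ⟨setIntegral_fderiv_le hP hφ hc hφ1 y, ?_⟩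
  simpa only [map_neg, integral_neg, norm_neg] using setIntegral_fderiv_le hP hφ hc hφ1 (-y)

lemma abs_setIntegral_translate_sub_le {A : Set (Euc d)} (hA : NullMeasurableSet A volume)
    (hA' : volume A < ⊤) (hP : perimeter A < ⊤) {φ : Euc d → ℝ} (hφ : ContDiff ℝ 1 φ)
    (hc : HasCompactSupport φ) (hφ1 : ∀ x, |φ x| ≤ 1) (y : Euc d) :
    |(∫ x in A, φ (x - y)) - ∫ x in A, φ x| ≤ ‖y‖ * (perimeter A).toReal := by
  simp only [← integral_indicator_one_mul hA]
  refine abs_integral_mul_translate_sub_le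
    ((memLp_indicator_one hA hA' 1).locallyIntegrable le_rfl) hφ hc y fun z => ?_
  rw [integral_indicator_one_mul hA]
  simpa only [fderiv_comp_sub] using abs_setIntegral_fderiv_le hP (contDiff_comp_sub hφ z)
    (hasCompactSupport_comp_sub hc z) (fun x => hφ1 _) y

lemma measureReal_sub_setIntegral_indicator_translate_le {A : Set (Euc d)}
    (hA : NullMeasurableSet A volume) (hA' : volume A < ⊤) (hP : perimeter A < ⊤) (y : Euc d) :
    volume.real A - ∫ x in A, A.indicator 1 (x + y) ≤ ‖y‖ * (perimeter A).toReal := by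
  refine le_of_forall_pos_le_add fun ε hε => ?_
  obtain ⟨φ, hφ, hc, hφ1, hclose⟩ := exists_test_integral_abs_indicator_sub_le hA hA' (half_pos hε)
  have hφi : Integrable φ := hφ.continuous.integrable_of_hasCompactSupport hc
  have hi : Integrable (A.indicator (1 : Euc d → ℝ)) :=
    memLp_one_iff_integrable.1 (memLp_indicator_one hA hA' 1)
  have htranslate := (abs_le.1 (abs_setIntegral_translate_sub_le hA hA' hP
    (hφ.of_le (by exact_mod_cast le_top)) hc hφ1 (-y))).1
  simp only [sub_neg_eq_add, norm_neg] at htranslate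
  have herror := (abs_le.1 ((abs_setIntegral_sub_setIntegral_le hi hφi (A := A)).trans hclose)).2
  have herror_translate := (abs_le.1 ((abs_setIntegral_sub_setIntegral_le
    (hi.comp_add_right y) (hφi.comp_add_right y) (A := A)).trans
    ((integral_add_right_eq_self (fun x => |A.indicator 1 x - φ x|) y).trans_le hclose))).1
  have hone : ∫ x in A, A.indicator (1 : Euc d → ℝ) x = volume.real A := by
    rw [setIntegral_congr_fun₀ hA (Set.eqOn_indicator (f := 1))]
    simp
  linarith

/-- With `r` chosen so that `|B_r| = 2|A|` this is the isoperimetric inequality, up to the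
constant. -/
lemma measureReal_le_mul_perimeter {A : Set (Euc d)} (hA : NullMeasurableSet A volume)
    (hA' : volume A < ⊤) (hP : perimeter A < ⊤) {r : ℝ} (hr : 0 < r)
    (hball : 2 * volume.real A ≤ volume.real (ball (0 : Euc d) r)) :
    volume.real A ≤ 2 * r * (perimeter A).toReal := by
  obtain ⟨y, hy, hhalf⟩ := exists_mem_ball_integral_abs_mul_translate_le_half hA'
    (memLp_indicator_one hA hA' 2) (Filter.Eventually.of_forall fun x hx => by simp [hx]) hr hball
  have habs : ∀ x, |A.indicator (1 : Euc d → ℝ) x| = A.indicator 1 x := fun x =>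
    abs_of_nonneg (Set.indicator_nonneg (fun _ _ => zero_le_one) x)
  have hsq : ∫ x, A.indicator (1 : Euc d → ℝ) x ^ 2 = volume.real A := by
    simp [sq, integral_indicator_one_mul hA,
      setIntegral_congr_fun₀ hA (Set.eqOn_indicator (f := 1))]
  simp only [habs, integral_indicator_one_mul hA, hsq] at hhalf
  have htranslate := measureReal_sub_setIntegral_indicator_translate_le hA hA' hP y
  have hyr : ‖y‖ * (perimeter A).toReal ≤ r * (perimeter A).toReal :=
    mul_le_mul_of_nonneg_right (mem_ball_zero_iff.1 hy).le ENNReal.toReal_nonneg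
  linarith

end Perimeter

section SobolevAlgebra

lemma integrable_mul_fderiv {E : Type*} [NormedAddCommGroup E] [NormedSpace ℝ E]
    [MeasurableSpace E] [BorelSpace E] {μ : Measure E} [IsFiniteMeasureOnCompacts μ] {u φ : E → ℝ}
    (hu : MemLp u 2 μ) (hφ : ContDiff ℝ 1 φ) (hc : HasCompactSupport φ) (v : E) :
    Integrable (fun x => u x * fderiv ℝ φ x v) μ :=
  hu.integrable_mul (q := 2) (((hφ.continuous_fderiv one_ne_zero).clm_apply
    continuous_const).memLp_of_hasCompactSupport (hc.fderiv_apply ℝ v))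

lemma integrable_inner_mul {E H : Type*} [TopologicalSpace E] [MeasurableSpace E]
    [OpensMeasurableSpace E] [NormedAddCommGroup H] [InnerProductSpace ℝ H] {μ : Measure E}
    [IsFiniteMeasureOnCompacts μ] {g : E → H} {φ : E → ℝ} (hg : MemLp g 2 μ) (hφ : Continuous φ)
    (hc : HasCompactSupport φ) (v : H) : Integrable (fun x => inner ℝ (g x) v * φ x) μ :=
  (hg.inner_const v).integrable_mul (q := 2) (hφ.memLp_of_hasCompactSupport hc)

variable {d : ℕ} {A : Set (Euc d)} {u u₁ u₂ : Euc d → ℝ} {g g₁ g₂ : Euc d → Euc d}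

lemma IsH1With.add (h₁ : IsH1With u₁ g₁) (h₂ : IsH1With u₂ g₂) :
    IsH1With (u₁ + u₂) (g₁ + g₂) where
  memLp := h₁.memLp.add h₂.memLp
  memLp_grad := h₁.memLp_grad.add h₂.memLp_grad
  integral_by_parts φ hφ hc v := by
    have hφ1 : ContDiff ℝ 1 φ := hφ.of_le (by exact_mod_cast le_top)
    simp only [Pi.add_apply, add_mul, inner_add_left]
    rw [integral_add (integrable_mul_fderiv h₁.memLp hφ1 hc v)
        (integrable_mul_fderiv h₂.memLp hφ1 hc v),
      integral_add (integrable_inner_mul h₁.memLp_grad hφ.continuous hc v)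
        (integrable_inner_mul h₂.memLp_grad hφ.continuous hc v),
      h₁.integral_by_parts φ hφ hc v, h₂.integral_by_parts φ hφ hc v]
    ring

lemma IsH1With.const_smul (h : IsH1With u g) (c : ℝ) : IsH1With (c • u) (c • g) where
  memLp := h.memLp.const_smul c
  memLp_grad := h.memLp_grad.const_smul c
  integral_by_parts φ hφ hc v := by
    simp only [Pi.smul_apply, smul_eq_mul, real_inner_smul_left, mul_assoc, integral_const_mul,
      h.integral_by_parts φ hφ hc v, mul_neg]

lemma IsH1With.congr (h : IsH1With u₁ g₁) (hu : u₁ =ᵐ[volume] u₂) (hg : g₁ =ᵐ[volume] g₂) :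
    IsH1With u₂ g₂ where
  memLp := (memLp_congr_ae hu).1 h.memLp
  memLp_grad := (memLp_congr_ae hg).1 h.memLp_grad
  integral_by_parts φ hφ hc v := calc
    ∫ x, u₂ x * fderiv ℝ φ x v = ∫ x, u₁ x * fderiv ℝ φ x v :=
      integral_congr_ae (hu.mono fun x hx => by simp only [hx])
    _ = -∫ x, inner ℝ (g₁ x) v * φ x := h.integral_by_parts φ hφ hc v
    _ = -∫ x, inner ℝ (g₂ x) v * φ x :=
      congrArg Neg.neg (integral_congr_ae (hg.mono fun x hx => by simp only [hx]))

lemma IsSobolevLike.add (h₁ : IsSobolevLike A u₁ g₁) (h₂ : IsSobolevLike A u₂ g₂) :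
    IsSobolevLike A (u₁ + u₂) (g₁ + g₂) where
  isH1 := h₁.isH1.add h₂.isH1
  ae_eq_zero := by
    filter_upwards [h₁.ae_eq_zero, h₂.ae_eq_zero] with x hx₁ hx₂ hxA
    rw [Pi.add_apply, hx₁ hxA, hx₂ hxA, add_zero]

lemma IsSobolevLike.const_smul (h : IsSobolevLike A u g) (c : ℝ) :
    IsSobolevLike A (c • u) (c • g) where
  isH1 := h.isH1.const_smul c
  ae_eq_zero := h.ae_eq_zero.mono fun x hx hxA => by rw [Pi.smul_apply, hx hxA, smul_zero]

lemma IsSobolevLike.sub (h₁ : IsSobolevLike A u₁ g₁) (h₂ : IsSobolevLike A u₂ g₂) :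
    IsSobolevLike A (u₁ - u₂) (g₁ - g₂) := by
  simpa only [neg_smul, one_smul, ← sub_eq_add_neg] using h₁.add (h₂.const_smul (-1))

lemma IsSobolevLike.zero (A : Set (Euc d)) : IsSobolevLike A 0 0 where
  isH1 := ⟨MemLp.zero, MemLp.zero, fun φ _ _ v => by simp⟩
  ae_eq_zero := .of_forall fun _ _ => rfl

lemma IsSobolevLike.congr (h : IsSobolevLike A u₁ g₁) (hu : u₁ =ᵐ[volume] u₂)
    (hg : g₁ =ᵐ[volume] g₂) : IsSobolevLike A u₂ g₂ where
  isH1 := h.isH1.congr hu hg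
  ae_eq_zero := by
    filter_upwards [h.ae_eq_zero, hu] with x hx hxu hxA
    rw [← hxu, hx hxA]

lemma IsSobolevLike.mono {B : Set (Euc d)} (hAB : A ⊆ B) (h : IsSobolevLike A u g) :
    IsSobolevLike B u g where
  isH1 := h.isH1
  ae_eq_zero := h.ae_eq_zero.mono fun _ hx hxB => hx fun hxA => hxB (hAB hxA)

end SobolevAlgebra

section SmoothMultiplier

variable {d : ℕ}

/-- A smooth function which is bounded together with its gradient, so that multiplication by it
preserves `H¹(ℝ^d)`. Boundedness is expressed as membership of `L^∞`. -/
structure IsSmoothMultiplier (η : Euc d → ℝ) : Prop where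
  contDiff : ContDiff ℝ ∞ η
  memLp_top : MemLp η ⊤ volume
  memLp_top_gradient : MemLp (gradient η) ⊤ volume

lemma gradient_const_sub {E : Type*} [NormedAddCommGroup E] [InnerProductSpace ℝ E]
    [CompleteSpace E] (c : ℝ) (η : E → ℝ) (x : E) :
    gradient (fun x => c - η x) x = -gradient η x := by
  simp only [gradient, fderiv_const_sub, map_neg]

variable {A : Set (Euc d)} {u η : Euc d → ℝ} {g : Euc d → Euc d}

lemma IsSmoothMultiplier.one_sub (hη : IsSmoothMultiplier η) :
    IsSmoothMultiplier (fun x => 1 - η x) where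
  contDiff := contDiff_const.sub hη.contDiff
  memLp_top := (memLp_top_const 1).sub hη.memLp_top
  memLp_top_gradient := by
    rw [funext (gradient_const_sub 1 η)]
    exact hη.memLp_top_gradient.neg

lemma fderiv_mul_eq_add_inner_gradient {η φ : Euc d → ℝ} {x : Euc d}
    (hη : DifferentiableAt ℝ η x) (hφ : DifferentiableAt ℝ φ x) (v : Euc d) :
    fderiv ℝ (fun x => η x * φ x) x v =
      η x * fderiv ℝ φ x v + inner ℝ (gradient η x) v * φ x := by
  rw [fderiv_fun_mul hη hφ, inner_gradient_left]
  simp [mul_comm]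

lemma IsH1With.mul (h : IsH1With u g) (hη : IsSmoothMultiplier η) :
    IsH1With (fun x => η x * u x) (fun x => η x • g x + u x • gradient η x) where
  memLp := h.memLp.mul' hη.memLp_top
  memLp_grad := (h.memLp_grad.smul hη.memLp_top).add (hη.memLp_top_gradient.smul h.memLp)
  integral_by_parts φ hφ hc v := by
    have hparts := h.integral_by_parts _ (hη.contDiff.mul hφ) hc.mul_left v
    simp only [fderiv_mul_eq_add_inner_gradient (hη.contDiff.differentiable (by simp) _)
      (hφ.differentiable (by simp) _)] at hparts
    have hu : Integrable (fun x => η x * u x * fderiv ℝ φ x v) :=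
      integrable_mul_fderiv (h.memLp.mul' hη.memLp_top) (hφ.of_le (by exact_mod_cast le_top)) hc v
    have huη : Integrable (fun x => inner ℝ (u x • gradient η x) v * φ x) :=
      integrable_inner_mul (hη.memLp_top_gradient.smul h.memLp) hφ.continuous hc v
    have hg : Integrable (fun x => inner ℝ (η x • g x) v * φ x) :=
      integrable_inner_mul (h.memLp_grad.smul hη.memLp_top) hφ.continuous hc v
    have hleft : ∫ x, u x * (η x * fderiv ℝ φ x v + inner ℝ (gradient η x) v * φ x) =
        (∫ x, η x * u x * fderiv ℝ φ x v) + ∫ x, inner ℝ (u x • gradient η x) v * φ x := by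
      rw [← integral_add hu huη]
      congr 1 with x
      rw [real_inner_smul_left]
      ring
    have hright : ∫ x, inner ℝ (g x) v * (η x * φ x) = ∫ x, inner ℝ (η x • g x) v * φ x := by
      congr 1 with x
      rw [real_inner_smul_left]
      ring
    simp only [inner_add_left, add_mul]
    rw [integral_add hg huη]
    linarith

lemma IsSobolevLike.mul_of_eq_zero {B : Set (Euc d)} (h : IsSobolevLike A u g)
    (hη : IsSmoothMultiplier η) (hηB : ∀ x ∈ A, x ∉ B → η x = 0) :
    IsSobolevLike B (fun x => η x * u x) (fun x => η x • g x + u x • gradient η x) where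
  isH1 := h.isH1.mul hη
  ae_eq_zero := h.ae_eq_zero.mono fun x hx hxB => by
    by_cases hxA : x ∈ A
    · rw [hηB x hxA hxB, zero_mul]
    · rw [hx hxA, mul_zero]

lemma IsSobolevLike.mul (h : IsSobolevLike A u g) (hη : IsSmoothMultiplier η) :
    IsSobolevLike A (fun x => η x * u x) (fun x => η x • g x + u x • gradient η x) :=
  h.mul_of_eq_zero hη fun _ hxA hxA' => absurd hxA hxA'

end SmoothMultiplier

section LaxMilgram

lemma exists_forall_inner_snd_eq_inner_fst {H₁ H₂ : Type*} [NormedAddCommGroup H₁]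
    [InnerProductSpace ℝ H₁] [CompleteSpace H₁] [NormedAddCommGroup H₂] [InnerProductSpace ℝ H₂]
    [CompleteSpace H₂] {V : Submodule ℝ (WithLp 2 (H₁ × H₂))}
    (hV : IsClosed (V : Set (WithLp 2 (H₁ × H₂)))) {C : ℝ} (hC : 0 ≤ C)
    (hpoincare : ∀ p ∈ V, ‖p.fst‖ ^ 2 ≤ C * ‖p.snd‖ ^ 2) (χ : H₁) :
    ∃ w ∈ V, ∀ q ∈ V, inner ℝ w.snd q.snd = inner ℝ χ q.fst := by
  have : CompleteSpace V := hV.completeSpace_coe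
  let π₁ : V →L[ℝ] H₁ := (WithLp.fstL 2 ℝ H₁ H₂).comp V.subtypeL
  let π₂ : V →L[ℝ] H₂ := (WithLp.sndL 2 ℝ H₁ H₂).comp V.subtypeL
  let B : V →L[ℝ] V →L[ℝ] ℝ := (innerSL ℝ).bilinearComp π₂ π₂
  have hB : ∀ p q : V, B p q = inner ℝ p.1.snd q.1.snd := fun p q => rfl
  have hcoercive : IsCoercive B := by
    refine ⟨(C + 1)⁻¹, by positivity, fun p => ?_⟩
    have hnorm : ‖p‖ ^ 2 = ‖p.1.fst‖ ^ 2 + ‖p.1.snd‖ ^ 2 := WithLp.prod_norm_sq_eq_of_L2 p.1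
    rw [hB, real_inner_self_eq_norm_sq, mul_assoc, ← sq, inv_mul_le_iff₀ (by positivity), hnorm]
    linarith [hpoincare p.1 p.2]
  let F : V := (InnerProductSpace.toDual ℝ V).symm ((innerSL ℝ χ).comp π₁)
  refine ⟨hcoercive.continuousLinearEquivOfBilin.symm F, Subtype.prop _, fun q hq => ?_⟩
  have hsol : B (hcoercive.continuousLinearEquivOfBilin.symm F) ⟨q, hq⟩ =
      (innerSL ℝ χ).comp π₁ ⟨q, hq⟩ := by
    rw [← hcoercive.continuousLinearEquivOfBilin_apply, ContinuousLinearEquiv.apply_symm_apply,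
      InnerProductSpace.toDual_symm_apply]
  exact hsol

end LaxMilgram

section Lp

variable {α : Type*} [MeasurableSpace α] {μ : Measure α}
  {H : Type*} [NormedAddCommGroup H] [InnerProductSpace ℝ H]

lemma continuous_integral_inner {f : α → H} (hf : MemLp f 2 μ) :
    Continuous fun u : Lp H 2 μ => ∫ x, inner ℝ (u x) (f x) ∂μ := by
  have hinner : ∀ u : Lp H 2 μ, ∫ x, inner ℝ (u x) (f x) ∂μ = inner ℝ u (hf.toLp f) := fun u => by
    rw [← inner_toLp_toLp (Lp.memLp u), Lp.toLp_coeFn]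
  simp only [hinner]
  fun_prop

lemma isClosed_setOf_ae_eq_zero {F : Type*} [NormedAddCommGroup F] [NormedSpace ℝ F] {p : ℝ≥0∞}
    [Fact (1 ≤ p)] {A : Set α} (hA : NullMeasurableSet A μ) :
    IsClosed {u : Lp F p μ | ∀ᵐ x ∂μ, x ∉ A → u x = 0} := by
  have hker : {u : Lp F p μ | ∀ᵐ x ∂μ, x ∉ A → u x = 0} =
      LpToLpRestrictCLM α F ℝ μ p Aᶜ ⁻¹' {0} := by
    ext u
    rw [Set.mem_preimage, Set.mem_singleton_iff, Lp.eq_zero_iff_ae_eq_zero]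
    refine (ae_restrict_iff'₀ hA.compl).symm.trans ?_
    exact Filter.eventually_congr <| (LpToLpRestrictCLM_coeFn ℝ Aᶜ u).mono fun x hx => by
      rw [hx, Pi.zero_apply]
  rw [hker]
  exact isClosed_singleton.preimage (LpToLpRestrictCLM α F ℝ μ p Aᶜ).continuous

end Lp

section BallVolume

variable {E : Type*} [NormedAddCommGroup E] [NormedSpace ℝ E] [FiniteDimensional ℝ E]
  [Nontrivial E] [MeasurableSpace E] [BorelSpace E] (μ : Measure E) [μ.IsAddHaarMeasure]

lemma measureReal_ball {r : ℝ} (hr : 0 ≤ r) (x : E) :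
    μ.real (ball x r) = r ^ Module.finrank ℝ E * μ.real (ball 0 1) := by
  rw [← Measure.addHaar_real_closedBall_eq_addHaar_real_ball,
    Measure.addHaar_real_closedBall μ x hr]

lemma exists_le_measureReal_ball (a : ℝ) : ∃ r : ℝ, 0 < r ∧ a ≤ μ.real (ball (0 : E) r) := by
  have hω : 0 < μ.real (ball (0 : E) 1) :=
    ENNReal.toReal_pos (measure_ball_pos _ _ one_pos).ne' measure_ball_lt_top.ne
  have hr : 1 ≤ max 1 (a / μ.real (ball (0 : E) 1)) := le_max_left _ _
  refine ⟨_, one_pos.trans_le hr, ?_⟩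
  rw [measureReal_ball μ (zero_le_one.trans hr), ← div_le_iff₀ hω]
  exact (le_max_right _ _).trans (le_self_pow₀ hr Module.finrank_pos.ne')

end BallVolume

section TorsionFunction

variable {d : ℕ} {A : Set (Euc d)} {w : Euc d → ℝ} {g : Euc d → Euc d}

/-- The Hilbert space `L²(ℝ^d) × L²(ℝ^d; ℝ^d)` in which the pairs `(u, ∇u)` live. -/
abbrev L2Pair (d : ℕ) : Type :=
  WithLp 2 (Lp ℝ 2 (volume : Measure (Euc d)) × Lp (Euc d) 2 (volume : Measure (Euc d)))

/-- The pairs `(u, ∇u)` with `u` in the Sobolev-like space of `A`, as a subspace of `L² × L²`. -/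
noncomputable def sobolevLikeSubmodule (A : Set (Euc d)) : Submodule ℝ (L2Pair d) where
  carrier := {p | IsSobolevLike A p.fst p.snd}
  zero_mem' := (IsSobolevLike.zero A).congr (Lp.coeFn_zero _ _ _).symm (Lp.coeFn_zero _ _ _).symm
  add_mem' hp hq := (IsSobolevLike.add hp hq).congr (Lp.coeFn_add _ _).symm
    (Lp.coeFn_add _ _).symm
  smul_mem' c _ hp := (IsSobolevLike.const_smul hp c).congr (Lp.coeFn_smul _ _).symm
    (Lp.coeFn_smul _ _).symm

lemma mem_sobolevLikeSubmodule {p : L2Pair d} :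
    p ∈ sobolevLikeSubmodule A ↔ IsSobolevLike A p.fst p.snd := Iff.rfl

lemma isClosed_setOf_isH1With : IsClosed {p : L2Pair d | IsH1With p.fst p.snd} := by
  have hset : {p : L2Pair d | IsH1With p.fst p.snd} =
      ⋂ (φ : Euc d → ℝ) (_ : ContDiff ℝ ∞ φ) (_ : HasCompactSupport φ) (v : Euc d),
        {p | ∫ x, inner ℝ (p.fst x) (fderiv ℝ φ x v) = -∫ x, inner ℝ (p.snd x) (φ x • v)} := by
    ext p
    have hsmul : ∀ (a v : Euc d) (c : ℝ), inner ℝ a (c • v) = inner ℝ a v * c := fun a v c => by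
      rw [real_inner_smul_right, mul_comm]
    simp only [Set.mem_iInter, Set.mem_ofPred_eq, hsmul, Real.inner_apply]
    exact ⟨fun h => h.integral_by_parts, fun h => ⟨Lp.memLp _, Lp.memLp _, h⟩⟩
  rw [hset]
  refine isClosed_iInter fun φ => isClosed_iInter fun hφ => isClosed_iInter fun hc =>
    isClosed_iInter fun v => isClosed_eq ?_ ?_
  · exact (continuous_integral_inner (((hφ.continuous_fderiv (by simp)).clm_apply
      continuous_const).memLp_of_hasCompactSupport (hc.fderiv_apply ℝ v))).comp
      (WithLp.fstL 2 ℝ _ _).continuous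
  · exact ((continuous_integral_inner ((hφ.continuous.smul
      continuous_const).memLp_of_hasCompactSupport hc.smul_right)).comp
      (WithLp.sndL 2 ℝ _ _).continuous).neg

lemma isClosed_sobolevLikeSubmodule (hA : NullMeasurableSet A volume) :
    IsClosed (sobolevLikeSubmodule A : Set (L2Pair d)) := by
  have hset : (sobolevLikeSubmodule A : Set (L2Pair d)) = {p | IsH1With p.fst p.snd} ∩
      (fun p => p.fst) ⁻¹' {u | ∀ᵐ x, x ∉ A → u x = 0} :=
    Set.ext fun p => ⟨fun h => ⟨h.isH1, h.ae_eq_zero⟩, fun h => ⟨h.1, h.2⟩⟩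
  rw [hset]
  exact isClosed_setOf_isH1With.inter
    ((isClosed_setOf_ae_eq_zero hA).preimage (WithLp.fstL 2 ℝ _ _).continuous)

lemma norm_fst_sq_le_of_mem_sobolevLikeSubmodule (hA : volume A < ⊤) {r : ℝ} (hr : 0 < r)
    (hball : 2 * volume.real A ≤ volume.real (ball (0 : Euc d) r)) {p : L2Pair d}
    (hp : p ∈ sobolevLikeSubmodule A) : ‖p.fst‖ ^ 2 ≤ r ^ 2 * ‖p.snd‖ ^ 2 := by
  have hpoincare := (mem_sobolevLikeSubmodule.1 hp).integral_sq_le hA hr hball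
  rw [← Lp.toLp_coeFn p.fst (Lp.memLp _), ← Lp.toLp_coeFn p.snd (Lp.memLp _), norm_toLp_sq,
    norm_toLp_sq]
  simpa only [Real.norm_eq_abs, sq_abs] using hpoincare

/-- `w`, with `∇w = g`, is the torsion function of `A`; unlike `IsTorsionFunction`, this gives
access to the gradient. -/
structure IsTorsionPair (A : Set (Euc d)) (w : Euc d → ℝ) (g : Euc d → Euc d) : Prop where
  isSobolevLike : IsSobolevLike A w g
  weak_eq : ∀ (v : Euc d → ℝ) (h : Euc d → Euc d), IsSobolevLike A v h →
    ∫ x in A, inner ℝ (g x) (h x) = ∫ x in A, v x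

lemma IsTorsionPair.isTorsionFunction (h : IsTorsionPair A w g) : IsTorsionFunction A w :=
  ⟨g, h.isSobolevLike, h.weak_eq⟩

theorem exists_isTorsionPair [NeZero d] (hA : NullMeasurableSet A volume) (hA' : volume A < ⊤) :
    ∃ w g, IsTorsionPair A w g := by
  obtain ⟨r, hr, hball⟩ := exists_le_measureReal_ball (E := Euc d) volume (2 * volume.real A)
  have hχ : MemLp (A.indicator (1 : Euc d → ℝ)) 2 volume := memLp_indicator_one hA hA' 2
  obtain ⟨w, hw, hsol⟩ := exists_forall_inner_snd_eq_inner_fst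
    (isClosed_sobolevLikeSubmodule hA) (sq_nonneg r)
    (fun p hp => norm_fst_sq_le_of_mem_sobolevLikeSubmodule hA' hr hball hp) (hχ.toLp _)
  rw [mem_sobolevLikeSubmodule] at hw
  refine ⟨w.fst, w.snd, hw, fun v h hv => ?_⟩
  have hweak := hsol (WithLp.toLp 2 (hv.isH1.memLp.toLp v, hv.isH1.memLp_grad.toLp h))
    (mem_sobolevLikeSubmodule.2
      (hv.congr hv.isH1.memLp.coeFn_toLp.symm hv.isH1.memLp_grad.coeFn_toLp.symm))
  calc ∫ x in A, inner ℝ (w.snd x) (h x) = ∫ x, inner ℝ (w.snd x) (h x) :=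
        setIntegral_eq_integral_of_ae_compl_eq_zero
          ((hw.grad_ae_eq_zero hA hA').mono fun x hx hxA => by rw [hx hxA, inner_zero_left])
    _ = inner ℝ w.snd (hv.isH1.memLp_grad.toLp h) := by
        rw [← inner_toLp_toLp (Lp.memLp _), Lp.toLp_coeFn]
    _ = inner ℝ (hχ.toLp _) (hv.isH1.memLp.toLp v) := hweak
    _ = ∫ x in A, v x := by
        rw [inner_toLp_toLp_eq_integral_mul, integral_indicator_one_mul hA]

end TorsionFunction

section Energy

variable {d : ℕ} {A : Set (Euc d)} {w v η : Euc d → ℝ} {g h : Euc d → Euc d}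

lemma IsTorsionPair.setIntegral_norm_sq (hw : IsTorsionPair A w g) :
    ∫ x in A, ‖g x‖ ^ 2 = ∫ x in A, w x := by
  simpa only [real_inner_self_eq_norm_sq] using hw.weak_eq w g hw.isSobolevLike

lemma IsTorsionPair.torsionFunctional_eq_add (hw : IsTorsionPair A w g)
    (hv : IsSobolevLike A v h) :
    torsionFunctional A v h = torsionFunctional A w g + 1 / 2 * ∫ x in A, ‖h x - g x‖ ^ 2 := by
  have hg := hw.isSobolevLike.isH1.memLp_grad.restrict A
  have hh := hv.isH1.memLp_grad.restrict A
  have hgh := (integrable_inner_of_memLp hh hg).const_mul 2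
  have hsub : Integrable (fun x => ‖h x‖ ^ 2 - 2 * inner ℝ (h x) (g x)) (volume.restrict A) :=
    (integrable_norm_sq_of_memLp hh).sub hgh
  have hexpand : ∫ x in A, ‖h x - g x‖ ^ 2 =
      (∫ x in A, ‖h x‖ ^ 2) - 2 * (∫ x in A, v x) + ∫ x in A, w x := by
    simp only [norm_sub_sq_real]
    rw [integral_add hsub (integrable_norm_sq_of_memLp hg),
      integral_sub (integrable_norm_sq_of_memLp hh) hgh, integral_const_mul,
      hw.setIntegral_norm_sq, ← hw.weak_eq v h hv]
    simp only [real_inner_comm]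
  rw [hexpand, torsionFunctional, torsionFunctional, hw.setIntegral_norm_sq]
  ring

lemma IsTorsionPair.isLeast (hw : IsTorsionPair A w g) :
    IsLeast {e : ℝ | ∃ (v : Euc d → ℝ) (h : Euc d → Euc d),
      IsSobolevLike A v h ∧ e = torsionFunctional A v h} (torsionFunctional A w g) := by
  refine ⟨⟨w, g, hw.isSobolevLike, rfl⟩, ?_⟩
  rintro _ ⟨v, h, hv, rfl⟩
  rw [hw.torsionFunctional_eq_add hv]
  exact le_add_of_nonneg_right (by positivity)

lemma IsTorsionPair.energy_eq (hw : IsTorsionPair A w g) : energy A = torsionFunctional A w g :=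
  hw.isLeast.csInf_eq

lemma IsTorsionPair.energy_le (hw : IsTorsionPair A w g) (hv : IsSobolevLike A v h) :
    energy A ≤ torsionFunctional A v h :=
  hw.energy_eq.trans_le (hw.isLeast.2 ⟨v, h, hv, rfl⟩)

lemma norm_smul_add_smul_sq {H : Type*} [NormedAddCommGroup H] [InnerProductSpace ℝ H] (a b : ℝ)
    (x y : H) :
    ‖a • x + b • y‖ ^ 2 = inner ℝ x (a • (a • x + b • y) + (a * b) • y) + ‖b • y‖ ^ 2 := by
  rw [norm_add_sq_real]
  simp only [norm_smul, inner_add_right, real_inner_smul_right, real_inner_smul_left, mul_pow,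
    real_inner_self_eq_norm_sq, Real.norm_eq_abs, sq_abs]
  ring

/-- Caccioppoli's identity: test the equation of `w` against `η² w`. -/
lemma IsTorsionPair.setIntegral_norm_grad_mul_sq (hw : IsTorsionPair A w g)
    (hη : IsSmoothMultiplier η) :
    ∫ x in A, ‖η x • g x + w x • gradient η x‖ ^ 2 =
      (∫ x in A, η x ^ 2 * w x) + ∫ x in A, ‖w x • gradient η x‖ ^ 2 := by
  have htest := (hw.isSobolevLike.mul hη).mul hη
  have hwη : MemLp (fun x => w x • gradient η x) 2 volume :=
    hη.memLp_top_gradient.smul hw.isSobolevLike.isH1.memLp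
  simp only [norm_smul_add_smul_sq (η _)]
  rw [integral_add (integrable_inner_of_memLp (hw.isSobolevLike.isH1.memLp_grad.restrict A)
      (htest.isH1.memLp_grad.restrict A)) (integrable_norm_sq_of_memLp (hwη.restrict A)),
    hw.weak_eq _ _ htest]
  simp only [sq, mul_assoc]

lemma IsTorsionPair.torsionFunctional_mul_sub (hw : IsTorsionPair A w g)
    (hη : IsSmoothMultiplier η) :
    torsionFunctional A (fun x => η x * w x) (fun x => η x • g x + w x • gradient η x) -
      torsionFunctional A w g =
      1 / 2 * ((∫ x in A, (1 - η x) ^ 2 * w x) + ∫ x in A, ‖w x • gradient η x‖ ^ 2) := by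
  have hflip : ∀ x, ‖η x • g x + w x • gradient η x - g x‖ ^ 2 =
      ‖(1 - η x) • g x + w x • gradient (fun x => 1 - η x) x‖ ^ 2 := fun x => by
    rw [gradient_const_sub, ← norm_neg]
    congr 2
    module
  rw [hw.torsionFunctional_eq_add (hw.isSobolevLike.mul hη), add_sub_cancel_left]
  simp only [hflip]
  rw [hw.setIntegral_norm_grad_mul_sq hη.one_sub]
  simp only [gradient_const_sub, smul_neg, norm_neg]

end Energy

section Cutoff

variable {E : Type*} [NormedAddCommGroup E] [InnerProductSpace ℝ E] {e : E} {a δ : ℝ} {x : E}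

/-- The open half space beyond the hyperplane `⟪e, x⟫ = t`. -/
def halfSpace (e : E) (t : ℝ) : Set E := {x | t < inner ℝ e x}

lemma mem_halfSpace {t : ℝ} : x ∈ halfSpace e t ↔ t < inner ℝ e x := Iff.rfl

lemma measurableSet_halfSpace [MeasurableSpace E] [OpensMeasurableSpace E] (e : E) (t : ℝ) :
    MeasurableSet (halfSpace e t) :=
  (isOpen_lt continuous_const (continuous_const.inner continuous_id)).measurableSet

lemma antitone_halfSpace (e : E) : Antitone (halfSpace e) := fun _ _ hst _ hx => hst.trans_lt hx

/-- The smooth cutoff function in direction `e`, equal to `0` where `⟪e, x⟫ ≤ a` and to `1` where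
`⟪e, x⟫ ≥ a + δ`. -/
noncomputable def cutoff (e : E) (a δ : ℝ) (x : E) : ℝ :=
  Real.smoothTransition ((inner ℝ e x - a) / δ)

lemma cutoff_nonneg (e : E) (a δ : ℝ) (x : E) : 0 ≤ cutoff e a δ x :=
  Real.smoothTransition.nonneg _

lemma cutoff_le_one (e : E) (a δ : ℝ) (x : E) : cutoff e a δ x ≤ 1 :=
  Real.smoothTransition.le_one _

lemma cutoff_eq_zero (hδ : 0 < δ) (hx : x ∉ halfSpace e a) : cutoff e a δ x = 0 :=
  Real.smoothTransition.zero_of_nonpos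
    (div_nonpos_of_nonpos_of_nonneg (sub_nonpos.2 (not_lt.1 hx)) hδ.le)

lemma cutoff_eq_one (hδ : 0 < δ) (hx : a + δ ≤ inner ℝ e x) : cutoff e a δ x = 1 :=
  Real.smoothTransition.one_of_one_le ((one_le_div hδ).2 (le_sub_iff_add_le'.2 hx))

lemma contDiff_cutoff (e : E) (a δ : ℝ) : ContDiff ℝ ∞ (cutoff e a δ) :=
  (Real.smoothTransition.contDiff (n := ⊤)).comp
    (((contDiff_const.inner ℝ contDiff_id).sub contDiff_const).div_const δ)

lemma abs_cutoff_sub_le (e : E) (a : ℝ) (hδ : 0 < δ) (x y : E) :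
    |cutoff e a δ x - cutoff e a δ y| ≤ transitionBound / δ * ‖e‖ * ‖x - y‖ :=
  calc |cutoff e a δ x - cutoff e a δ y|
      ≤ transitionBound * |(inner ℝ e x - a) / δ - (inner ℝ e y - a) / δ| :=
        abs_smoothTransition_sub_le _ _
    _ = transitionBound * (|inner ℝ e (x - y)| / δ) := by
        rw [← sub_div, sub_sub_sub_cancel_right, ← inner_sub_right, abs_div, abs_of_pos hδ]
    _ ≤ transitionBound * (‖e‖ * ‖x - y‖ / δ) := by
        have := transitionBound_nonneg
        gcongr
        exact abs_real_inner_le_norm e (x - y)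
    _ = transitionBound / δ * ‖e‖ * ‖x - y‖ := by ring

variable [CompleteSpace E]

lemma norm_gradient_cutoff_le (e : E) (a : ℝ) (hδ : 0 < δ) (x : E) :
    ‖gradient (cutoff e a δ) x‖ ≤ transitionBound / δ * ‖e‖ := by
  rw [gradient, LinearIsometryEquiv.norm_map]
  exact norm_fderiv_le_of_lip' ℝ (mul_nonneg (div_nonneg transitionBound_nonneg hδ.le)
    (norm_nonneg e)) (Filter.Eventually.of_forall fun y => abs_cutoff_sub_le e a hδ y x)

lemma gradient_cutoff_eq_zero (hδ : 0 < δ) (hx : x ∉ halfSpace e a) :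
    gradient (cutoff e a δ) x = 0 := by
  have hmin : IsLocalMin (cutoff e a δ) x := Filter.Eventually.of_forall fun y =>
    (cutoff_eq_zero hδ hx).trans_le (cutoff_nonneg e a δ y)
  rw [gradient, hmin.fderiv_eq_zero, map_zero]

lemma gradient_cutoff_eq_zero_of_mem (hδ : 0 < δ) (hx : x ∈ halfSpace e (a + δ)) :
    gradient (cutoff e a δ) x = 0 := by
  have hmax : IsLocalMax (cutoff e a δ) x := Filter.Eventually.of_forall fun y =>
    (cutoff_le_one e a δ y).trans_eq (cutoff_eq_one hδ (mem_halfSpace.1 hx).le).symm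
  rw [gradient, hmax.fderiv_eq_zero, map_zero]

lemma continuous_gradient_cutoff (e : E) (a δ : ℝ) : Continuous (gradient (cutoff e a δ)) :=
  (InnerProductSpace.toDual ℝ E).symm.continuous.comp
    ((contDiff_cutoff e a δ).continuous_fderiv (by simp))

end Cutoff

section TailMass

variable {d : ℕ} {A : Set (Euc d)} {w : Euc d → ℝ}

lemma isSmoothMultiplier_cutoff (e : Euc d) (a : ℝ) {δ : ℝ} (hδ : 0 < δ) :
    IsSmoothMultiplier (cutoff e a δ) where
  contDiff := contDiff_cutoff e a δ
  memLp_top := memLp_top_of_bound (contDiff_cutoff e a δ).continuous.aestronglyMeasurable 1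
    (Filter.Eventually.of_forall fun x => by
      rw [Real.norm_of_nonneg (cutoff_nonneg e a δ x)]
      exact cutoff_le_one e a δ x)
  memLp_top_gradient := memLp_top_of_bound (continuous_gradient_cutoff e a δ).aestronglyMeasurable _
    (Filter.Eventually.of_forall (norm_gradient_cutoff_le e a hδ))

/-- The integral of `1 + w²` over the part of `A` beyond the hyperplane `⟪e, x⟫ = t`. Cutting `A`
there raises the energy by at most a multiple of this quantity. -/
noncomputable def tailMass (A : Set (Euc d)) (w : Euc d → ℝ) (e : Euc d) (t : ℝ) : ℝ :=
  ∫ x in A ∩ halfSpace e t, (1 + w x ^ 2)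

lemma integrableOn_one_add_sq (hA : volume A < ⊤) (hw : MemLp w 2 volume) :
    IntegrableOn (fun x => 1 + w x ^ 2) A :=
  (integrableOn_const hA.ne).add hw.integrable_sq.integrableOn

lemma tailMass_eq_setIntegral_indicator (A : Set (Euc d)) (w : Euc d → ℝ) (e : Euc d) (t : ℝ) :
    tailMass A w e t = ∫ x in A, (halfSpace e t).indicator (fun x => 1 + w x ^ 2) x :=
  (setIntegral_indicator (measurableSet_halfSpace e t)).symm

lemma tailMass_eq_add (hA : volume A < ⊤) (hw : MemLp w 2 volume) (e : Euc d) (t : ℝ) :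
    tailMass A w e t = volume.real (A ∩ halfSpace e t) + ∫ x in A ∩ halfSpace e t, w x ^ 2 := by
  have hfin : volume (A ∩ halfSpace e t) < ⊤ := (measure_mono Set.inter_subset_left).trans_lt hA
  have hone : Integrable (fun _ : Euc d => (1 : ℝ)) (volume.restrict (A ∩ halfSpace e t)) :=
    integrableOn_const hfin.ne
  rw [tailMass, integral_add hone hw.integrable_sq.integrableOn]
  simp

lemma measureReal_le_tailMass (hA : volume A < ⊤) (hw : MemLp w 2 volume) (e : Euc d) (t : ℝ) :
    volume.real (A ∩ halfSpace e t) ≤ tailMass A w e t := by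
  rw [tailMass_eq_add hA hw]
  exact le_add_of_nonneg_right (by positivity)

lemma tailMass_nonneg (A : Set (Euc d)) (w : Euc d → ℝ) (e : Euc d) (t : ℝ) :
    0 ≤ tailMass A w e t := by unfold tailMass; positivity

lemma antitone_tailMass (hA : volume A < ⊤) (hw : MemLp w 2 volume) (e : Euc d) :
    Antitone (tailMass A w e) := fun _ _ hst =>
  setIntegral_mono_set ((integrableOn_one_add_sq hA hw).mono_set Set.inter_subset_left)
    (Filter.Eventually.of_forall fun x => add_nonneg zero_le_one (sq_nonneg (w x)))
    (Set.inter_subset_inter_right _ (antitone_halfSpace e hst)).eventuallyLE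

lemma setIntegral_le_tailMass (hA : volume A < ⊤) (hw : MemLp w 2 volume) (e : Euc d) (t : ℝ)
    {f : Euc d → ℝ} {c : ℝ} (hc : 0 ≤ c) (hf_out : ∀ x, x ∉ halfSpace e t → f x ≤ 0)
    (hf_le : ∀ x, f x ≤ c * (1 + w x ^ 2)) : ∫ x in A, f x ≤ c * tailMass A w e t := by
  rw [tailMass_eq_setIntegral_indicator, ← integral_const_mul]
  simp only [← Set.indicator_const_mul]
  by_cases hf : IntegrableOn f A
  · refine integral_mono hf (((integrableOn_one_add_sq hA hw).const_mul c).indicator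
      (measurableSet_halfSpace e t)) fun x => ?_
    by_cases hx : x ∈ halfSpace e t
    · rw [Set.indicator_of_mem hx]
      exact hf_le x
    · rw [Set.indicator_of_notMem hx]
      exact hf_out x hx
  · rw [integral_undef hf]
    exact integral_nonneg (Set.indicator_nonneg fun x _ => by positivity)

lemma tendsto_tailMass_atTop (hA : volume A < ⊤) (hw : MemLp w 2 volume) (e : Euc d) :
    Filter.Tendsto (tailMass A w e) Filter.atTop (nhds 0) := by
  have hint : Integrable (fun x => 1 + w x ^ 2) (volume.restrict A) :=
    integrableOn_one_add_sq hA hw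
  have hlim := tendsto_integral_filter_of_dominated_convergence (μ := volume.restrict A)
    (l := Filter.atTop) (f := fun _ => (0 : ℝ))
    (F := fun t : ℝ => (halfSpace e t).indicator fun x => 1 + w x ^ 2) (fun x => 1 + w x ^ 2)
    (Filter.Eventually.of_forall fun t => hint.1.indicator (measurableSet_halfSpace e t))
    (Filter.Eventually.of_forall fun t => Filter.Eventually.of_forall fun x =>
      (norm_indicator_le_norm_self _ _).trans_eq (Real.norm_of_nonneg (by positivity))) hint
    (Filter.Eventually.of_forall fun x => tendsto_const_nhds.congr' <|
      (Filter.eventually_ge_atTop (inner ℝ e x)).mono fun t ht =>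
        (Set.indicator_of_notMem (s := halfSpace e t) (not_lt.2 ht) _).symm)
  rw [funext (tailMass_eq_setIntegral_indicator A w e)]
  simpa only [integral_zero] using hlim

end TailMass

section Decay

variable {d : ℕ} {A : Set (Euc d)} {w : Euc d → ℝ} {g : Euc d → Euc d} {e : Euc d} {δ : ℝ}

/-- The constant in the Caccioppoli inequality for the cutoff functions. -/
noncomputable def caccioppoliConst : ℝ := 1 + transitionBound ^ 2

lemma caccioppoliConst_pos : 0 < caccioppoliConst := by unfold caccioppoliConst; positivity

lemma setIntegral_cutoff_sq_mul_add_le (hA : volume A < ⊤) (hw : MemLp w 2 volume) (he : ‖e‖ ≤ 1)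
    (t : ℝ) (hδ : 0 < δ) (hδ1 : δ ≤ 1) :
    (∫ x in A, cutoff e t δ x ^ 2 * w x) + ∫ x in A, ‖w x • gradient (cutoff e t δ) x‖ ^ 2 ≤
      caccioppoliConst / δ ^ 2 * tailMass A w e t := by
  have hcut : ∫ x in A, cutoff e t δ x ^ 2 * w x ≤ 1 * tailMass A w e t := by
    refine setIntegral_le_tailMass hA hw e t zero_le_one
      (fun x hx => by simp [cutoff_eq_zero hδ hx]) fun x => ?_
    have hη : cutoff e t δ x ^ 2 ≤ 1 :=
      pow_le_one₀ (cutoff_nonneg e t δ x) (cutoff_le_one e t δ x)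
    nlinarith [sq_nonneg (w x - 1), sq_nonneg (w x + 1), sq_nonneg (cutoff e t δ x)]
  have hgrad : ∫ x in A, ‖w x • gradient (cutoff e t δ) x‖ ^ 2 ≤
      (transitionBound / δ) ^ 2 * tailMass A w e t := by
    refine setIntegral_le_tailMass hA hw e t (sq_nonneg _)
      (fun x hx => by simp [gradient_cutoff_eq_zero hδ hx]) fun x => ?_
    have hγ : ‖gradient (cutoff e t δ) x‖ ≤ transitionBound / δ :=
      (norm_gradient_cutoff_le e t hδ x).trans
        (mul_le_of_le_one_right (div_nonneg transitionBound_nonneg hδ.le) he)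
    rw [norm_smul, mul_pow, Real.norm_eq_abs, sq_abs, mul_comm]
    gcongr
    exact le_add_of_nonneg_left zero_le_one
  have hδ2 : 1 ≤ 1 / δ ^ 2 := (one_le_div (by positivity)).2 (pow_le_one₀ hδ.le hδ1)
  calc _ ≤ 1 * tailMass A w e t + (transitionBound / δ) ^ 2 * tailMass A w e t :=
        add_le_add hcut hgrad
    _ ≤ 1 / δ ^ 2 * tailMass A w e t + (transitionBound / δ) ^ 2 * tailMass A w e t := by
        have := tailMass_nonneg A w e t
        gcongr
    _ = caccioppoliConst / δ ^ 2 * tailMass A w e t := by unfold caccioppoliConst; ring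

lemma IsSobolevLike.torsionFunctional_eq_of_subset {U : Set (Euc d)} {v : Euc d → ℝ}
    {h : Euc d → Euc d} (hv : IsSobolevLike U v h) (hU : NullMeasurableSet U volume)
    (hU' : volume U < ⊤) (hUA : U ⊆ A) : torsionFunctional A v h = torsionFunctional U v h := by
  have hextend : ∀ B, U ⊆ B → torsionFunctional B v h = 1 / 2 * (∫ x, ‖h x‖ ^ 2) - ∫ x, v x :=
    fun B hUB => by
      rw [torsionFunctional, setIntegral_eq_integral_of_ae_compl_eq_zero (hv.mono hUB).ae_eq_zero,
        setIntegral_eq_integral_of_ae_compl_eq_zero]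
      filter_upwards [hv.grad_ae_eq_zero hU hU'] with x hx hxB
      simp [hx fun hxU => hxB (hUB hxU)]
  rw [hextend A hUA, hextend U subset_rfl]

/-- The competitor for the energy of the cut set is `(1 - η) w`, with `η` the cutoff function. -/
lemma IsTorsionPair.energy_sdiff_halfSpace_sub_le (hA : NullMeasurableSet A volume)
    (hA' : volume A < ⊤) (hw : IsTorsionPair A w g) (he : ‖e‖ ≤ 1) {s t : ℝ} (hδ : 0 < δ)
    (hδ1 : δ ≤ 1) (hts : t + δ ≤ s) {wU : Euc d → ℝ} {gU : Euc d → Euc d}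
    (hwU : IsTorsionPair (A \ halfSpace e s) wU gU) :
    energy (A \ halfSpace e s) - energy A ≤
      1 / 2 * (caccioppoliConst / δ ^ 2 * tailMass A w e t) := by
  have hη := (isSmoothMultiplier_cutoff e t hδ).one_sub
  have hv := hw.isSobolevLike.mul_of_eq_zero (B := A \ halfSpace e s) hη
    fun x hxA hxU => by
      have hxs : x ∈ halfSpace e s := not_not.1 fun hx => hxU ⟨hxA, hx⟩
      rw [cutoff_eq_one hδ (hts.trans (mem_halfSpace.1 hxs).le), sub_self]
  have hdiff := hw.torsionFunctional_mul_sub hη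
  have hnorm : ∀ x, ‖w x • gradient (fun x => 1 - cutoff e t δ x) x‖ =
      ‖w x • gradient (cutoff e t δ) x‖ := fun x => by
    rw [gradient_const_sub, smul_neg, norm_neg]
  simp only [hnorm, sub_sub_cancel] at hdiff
  have hU := hv.torsionFunctional_eq_of_subset
    (hA.diff (measurableSet_halfSpace e _).nullMeasurableSet)
    ((measure_mono Set.sdiff_subset).trans_lt hA') Set.sdiff_subset
  have hle := hwU.energy_le hv
  have hcacc := setIntegral_cutoff_sq_mul_add_le hA' hw.isSobolevLike.isH1.memLp he t hδ hδ1
  rw [hw.energy_eq]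
  linarith

lemma IsTorsionPair.setIntegral_inter_halfSpace_sq_le (hA : NullMeasurableSet A volume)
    (hA' : volume A < ⊤) (hw : IsTorsionPair A w g) (he : ‖e‖ ≤ 1) {s t : ℝ} (hδ : 0 < δ)
    (hδ1 : δ ≤ 1) (hts : t + δ ≤ s) {r : ℝ} (hr : 0 < r)
    (hball : 2 * volume.real (A ∩ halfSpace e t) ≤ volume.real (ball (0 : Euc d) r)) :
    ∫ x in A ∩ halfSpace e s, w x ^ 2 ≤
      r ^ 2 * (caccioppoliConst / δ ^ 2 * tailMass A w e t) := by
  have hη := isSmoothMultiplier_cutoff e t hδ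
  have hwη : IsSobolevLike (A ∩ halfSpace e t) _ _ := hw.isSobolevLike.mul_of_eq_zero hη
    fun x hxA hx => cutoff_eq_zero hδ fun hxt => hx ⟨hxA, hxt⟩
  have hgrad := (hw.isSobolevLike.mul hη).grad_ae_eq_zero hA hA'
  calc ∫ x in A ∩ halfSpace e s, w x ^ 2
      = ∫ x in A ∩ halfSpace e s, (cutoff e t δ x * w x) ^ 2 :=
        setIntegral_congr_fun₀ (hA.inter (measurableSet_halfSpace e _).nullMeasurableSet)
          fun x hx => by
            simp only [cutoff_eq_one hδ (hts.trans (mem_halfSpace.1 hx.2).le), one_mul]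
    _ ≤ ∫ x, (cutoff e t δ x * w x) ^ 2 := setIntegral_le_integral hwη.isH1.memLp.integrable_sq
        (Filter.Eventually.of_forall fun x => sq_nonneg _)
    _ ≤ r ^ 2 * ∫ x, ‖cutoff e t δ x • g x + w x • gradient (cutoff e t δ) x‖ ^ 2 :=
        hwη.integral_sq_le ((measure_mono Set.inter_subset_left).trans_lt hA') hr hball
    _ = r ^ 2 * ∫ x in A, ‖cutoff e t δ x • g x + w x • gradient (cutoff e t δ) x‖ ^ 2 := by
        rw [setIntegral_eq_integral_of_ae_compl_eq_zero]
        exact hgrad.mono fun x hx hxA => by simp [hx hxA]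
    _ ≤ r ^ 2 * (caccioppoliConst / δ ^ 2 * tailMass A w e t) := by
        rw [hw.setIntegral_norm_grad_mul_sq hη]
        gcongr
        exact setIntegral_cutoff_sq_mul_add_le hA' hw.isSobolevLike.isH1.memLp he t hδ hδ1

lemma IsTorsionPair.integral_sub_sq_le {U : Set (Euc d)} (hA : NullMeasurableSet A volume)
    (hA' : volume A < ⊤) (hU : NullMeasurableSet U volume) (hUA : U ⊆ A) {wU : Euc d → ℝ}
    {gU : Euc d → Euc d} (hw : IsTorsionPair A w g) (hwU : IsTorsionPair U wU gU) {r : ℝ}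
    (hr : 0 < r) (hball : 2 * volume.real A ≤ volume.real (ball (0 : Euc d) r)) :
    ∫ x, (w x - wU x) ^ 2 ≤ 2 * r ^ 2 * (energy U - energy A) := by
  have hwUA := hwU.isSobolevLike.mono hUA
  have hsub := hw.isSobolevLike.sub hwUA
  have henergy := hw.torsionFunctional_eq_add hwUA
  rw [hwU.isSobolevLike.torsionFunctional_eq_of_subset hU ((measure_mono hUA).trans_lt hA') hUA,
    ← hw.energy_eq, ← hwU.energy_eq] at henergy
  simp only [norm_sub_rev] at henergy
  calc ∫ x, (w x - wU x) ^ 2 ≤ r ^ 2 * ∫ x, ‖g x - gU x‖ ^ 2 := hsub.integral_sq_le hA' hr hball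
    _ = r ^ 2 * ∫ x in A, ‖g x - gU x‖ ^ 2 := by
        rw [setIntegral_eq_integral_of_ae_compl_eq_zero]
        filter_upwards [hsub.grad_ae_eq_zero hA hA'] with x hx hxA
        simpa using hx hxA
    _ = 2 * r ^ 2 * (energy U - energy A) := by rw [henergy]; ring

end Decay

section PerimeterSplit

variable {d : ℕ} {A : Set (Euc d)} {X Y : Euc d → Euc d}

lemma divergence_zero : divergence (0 : Euc d → Euc d) = 0 := by
  ext x
  simp [divergence]

lemma continuous_divergence (hX : ContDiff ℝ 1 X) : Continuous (divergence X) :=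
  continuous_finsetSum _ fun i _ => (PiLp.continuous_apply 2 (fun _ => ℝ) i).comp
    ((hX.continuous_fderiv one_ne_zero).clm_apply continuous_const)

lemma hasCompactSupport_divergence (hX : HasCompactSupport X) :
    HasCompactSupport (divergence X) :=
  (hX.fderiv ℝ).mono' <| (Function.support_subset_iff'.2 fun x hx => by
    simp [divergence, Function.notMem_support.1 hx]).trans subset_closure

lemma integrable_divergence (hX : ContDiff ℝ 1 X) (hc : HasCompactSupport X) :
    Integrable (divergence X) :=
  (continuous_divergence hX).integrable_of_hasCompactSupport (hasCompactSupport_divergence hc)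

lemma divergence_interpolate {η : Euc d → ℝ} {x : Euc d} (hX : DifferentiableAt ℝ X x)
    (hY : DifferentiableAt ℝ Y x) (hη : DifferentiableAt ℝ η x) :
    divergence (fun x => (1 - η x) • X x + η x • Y x) x =
      (1 - η x) * divergence X x + η x * divergence Y x +
        inner ℝ (gradient η x) (Y x - X x) := by
  have hinner (v : Euc d) :
      inner ℝ (gradient η x) v = ∑ i, fderiv ℝ η x (EuclideanSpace.single i 1) * v i := by
    simp [← inner_gradient_left, PiLp.inner_apply, mul_comm]
  have hderiv : fderiv ℝ (fun x => (1 - η x) • X x + η x • Y x) x = _ :=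
    (((hη.hasFDerivAt.const_sub 1).smul hX.hasFDerivAt).add
      (hη.hasFDerivAt.smul hY.hasFDerivAt)).fderiv
  simp only [divergence, hinner, hderiv, Finset.mul_sum, ← Finset.sum_add_distrib]
  refine Finset.sum_congr rfl fun i _ => ?_
  simp
  ring

lemma IsPerimeterField.zero : IsPerimeterField (0 : Euc d → Euc d) :=
  ⟨contDiff_const, HasCompactSupport.zero, fun x => by simp⟩

lemma IsPerimeterField.interpolate (hX : IsPerimeterField X) (hY : IsPerimeterField Y)
    {η : Euc d → ℝ} (hη : ContDiff ℝ 1 η) (hη0 : ∀ x, 0 ≤ η x) (hη1 : ∀ x, η x ≤ 1) :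
    IsPerimeterField fun x => (1 - η x) • X x + η x • Y x where
  contDiff := ((contDiff_const.sub hη).smul hX.contDiff).add (hη.smul hY.contDiff)
  hasCompactSupport := (hX.hasCompactSupport.smul_left (f := fun x => 1 - η x)).add
    (hY.hasCompactSupport.smul_left (f := η))
  norm_le_one x := by
    have hmem := convex_closedBall (0 : Euc d) 1 (mem_closedBall_zero_iff.2 (hX.norm_le_one x))
      (mem_closedBall_zero_iff.2 (hY.norm_le_one x)) (sub_nonneg.2 (hη1 x)) (hη0 x)
      (sub_add_cancel 1 (η x))
    exact mem_closedBall_zero_iff.1 hmem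

lemma perimeter_add_perimeter_le_ofReal {B : Set (Euc d)} {c : ℝ}
    (h : ∀ X Y : Euc d → Euc d, IsPerimeterField X → IsPerimeterField Y →
      (∫ x in A, divergence X x) + ∫ x in B, divergence Y x ≤ c) :
    perimeter A + perimeter B ≤ ENNReal.ofReal c := by
  have : Nonempty {X : Euc d → Euc d // IsPerimeterField X} := ⟨⟨0, .zero⟩⟩
  rw [perimeter_eq_iSup, perimeter_eq_iSup]
  refine ENNReal.iSup_add_iSup_le fun ⟨X, hX⟩ ⟨Y, hY⟩ => ?_
  have hX0 := h X 0 hX .zero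
  have h0Y := h 0 Y .zero hY
  simp only [divergence_zero, Pi.zero_apply, integral_zero, add_zero, zero_add] at hX0 h0Y
  rcases le_total (∫ x in A, divergence X x) 0 with hXneg | hXpos
  · rw [ENNReal.ofReal_of_nonpos hXneg, zero_add]
    exact ENNReal.ofReal_le_ofReal h0Y
  rcases le_total (∫ x in B, divergence Y x) 0 with hYneg | hYpos
  · rw [ENNReal.ofReal_of_nonpos hYneg, add_zero]
    exact ENNReal.ofReal_le_ofReal hX0
  · rw [← ENNReal.ofReal_add hXpos hYpos]
    exact ENNReal.ofReal_le_ofReal (h X Y hX hY)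

lemma measureReal_inter_slab (hA : volume A < ⊤) (e : Euc d) {s t : ℝ} (hst : s ≤ t) :
    volume.real (A ∩ (halfSpace e s \ halfSpace e t)) =
      volume.real (A ∩ halfSpace e s) - volume.real (A ∩ halfSpace e t) := by
  have hsplit := measureReal_sdiff_add_inter (μ := volume) (s := A ∩ halfSpace e s)
    (measurableSet_halfSpace e t) ((measure_mono Set.inter_subset_left).trans_lt hA).ne
  rw [Set.inter_assoc, Set.inter_eq_right.2 (antitone_halfSpace e hst), Set.inter_sdiff_assoc]
    at hsplit
  linarith

lemma abs_inner_gradient_cutoff_le {E : Type*} [NormedAddCommGroup E] [InnerProductSpace ℝ E]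
    [CompleteSpace E] {e y : E} {M : ℝ} (he : ‖e‖ ≤ 1) (hy : ‖y‖ ≤ M) (s : ℝ) {δ : ℝ} (hδ : 0 < δ)
    (x : E) :
    |inner ℝ (gradient (cutoff e s δ) x) y| ≤
      (halfSpace e s \ halfSpace e (s + δ)).indicator (fun _ => transitionBound / δ * M) x := by
  by_cases hx : x ∈ halfSpace e s \ halfSpace e (s + δ)
  · rw [Set.indicator_of_mem hx]
    have hbound := div_nonneg transitionBound_nonneg hδ.le
    exact (abs_real_inner_le_norm _ _).trans (mul_le_mul ((norm_gradient_cutoff_le e s hδ x).trans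
      (mul_le_of_le_one_right hbound he)) hy (norm_nonneg y) hbound)
  · have hgrad : gradient (cutoff e s δ) x = 0 := by
      by_cases hxs : x ∈ halfSpace e s
      · exact gradient_cutoff_eq_zero_of_mem hδ (by_contra fun hxδ => hx ⟨hxs, hxδ⟩)
      · exact gradient_cutoff_eq_zero hδ hxs
    rw [Set.indicator_of_notMem hx, hgrad, inner_zero_left, abs_zero]

lemma abs_setIntegral_inner_gradient_cutoff_le (hA : volume A < ⊤) {e : Euc d} (he : ‖e‖ ≤ 1)
    {s c δ M : ℝ} (hδ : 0 < δ) (hM : 0 ≤ M)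
    (hc : volume.real (A ∩ halfSpace e s) - volume.real (A ∩ halfSpace e (s + δ)) ≤ c * δ)
    (hX : ∀ x, ‖X x‖ ≤ M) :
    |∫ x in A, inner ℝ (gradient (cutoff e s δ) x) (X x)| ≤ transitionBound * M * c := by
  have : IsFiniteMeasure (volume.restrict A) := isFiniteMeasure_restrict.2 hA.ne
  have hslab : MeasurableSet (halfSpace e s \ halfSpace e (s + δ)) :=
    (measurableSet_halfSpace e _).diff (measurableSet_halfSpace e _)
  have hbound := transitionBound_nonneg
  calc |∫ x in A, inner ℝ (gradient (cutoff e s δ) x) (X x)|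
      ≤ ∫ x in A, (halfSpace e s \ halfSpace e (s + δ)).indicator
          (fun _ => transitionBound / δ * M) x :=
        norm_integral_le_of_norm_le
          (f := fun x => inner ℝ (gradient (cutoff e s δ) x) (X x))
          ((integrable_const _).indicator hslab)
          (Filter.Eventually.of_forall fun x => abs_inner_gradient_cutoff_le he (hX x) s hδ x)
    _ = volume.real (A ∩ (halfSpace e s \ halfSpace e (s + δ))) * (transitionBound / δ * M) := by
        rw [setIntegral_indicator hslab, setIntegral_const, smul_eq_mul]
    _ ≤ c * δ * (transitionBound / δ * M) := by
        rw [measureReal_inter_slab hA e (by linarith)]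
        gcongr
    _ = transitionBound * M * c := by field_simp

lemma setIntegral_interpolate_divergence_le (hA : volume A < ⊤) (hP : perimeter A < ⊤)
    {e : Euc d} (he : ‖e‖ ≤ 1) {s c δ : ℝ} (hδ : 0 < δ)
    (hc : volume.real (A ∩ halfSpace e s) - volume.real (A ∩ halfSpace e (s + δ)) ≤ c * δ)
    (hX : IsPerimeterField X) (hY : IsPerimeterField Y) :
    ∫ x in A, ((1 - cutoff e s δ x) * divergence X x + cutoff e s δ x * divergence Y x) ≤
      (perimeter A).toReal + transitionBound * 2 * c := by
  have hη : ContDiff ℝ 1 (cutoff e s δ) := (contDiff_cutoff e s δ).of_le (by exact_mod_cast le_top)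
  have hfield := (hX.interpolate hY hη (cutoff_nonneg e s δ)
    (cutoff_le_one e s δ)).setIntegral_divergence_le hP
  simp only [fun x => divergence_interpolate (hX.contDiff.differentiable one_ne_zero x)
    (hY.contDiff.differentiable one_ne_zero x) (hη.differentiable one_ne_zero x)] at hfield
  have hdiv : Integrable fun x =>
      (1 - cutoff e s δ x) * divergence X x + cutoff e s δ x * divergence Y x :=
    (((continuous_const.sub hη.continuous).mul (continuous_divergence hX.contDiff)).add
      (hη.continuous.mul (continuous_divergence hY.contDiff))).integrable_of_hasCompactSupport
      ((hasCompactSupport_divergence hX.hasCompactSupport).mul_left.add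
        (hasCompactSupport_divergence hY.hasCompactSupport).mul_left)
  have hgrad : Integrable fun x => inner ℝ (gradient (cutoff e s δ) x) (Y x - X x) :=
    ((continuous_gradient_cutoff e s δ).inner (hY.contDiff.continuous.sub
      hX.contDiff.continuous)).integrable_of_hasCompactSupport
      ((hY.hasCompactSupport.sub hX.hasCompactSupport).mono' <|
        (Function.support_subset_iff'.2 fun x hx => by
          have hYX : Y x - X x = 0 := Function.notMem_support.1 hx
          rw [hYX, inner_zero_right]).trans subset_closure)
  have hslab := abs_setIntegral_inner_gradient_cutoff_le hA he hδ zero_le_two hc fun x =>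
    (norm_sub_le (Y x) (X x)).trans
      ((add_le_add (hY.norm_le_one x) (hX.norm_le_one x)).trans_eq one_add_one_eq_two)
  rw [integral_add hdiv.integrableOn hgrad.integrableOn] at hfield
  linarith [(abs_le.1 hslab).1]

lemma tendsto_cutoff {E : Type*} [NormedAddCommGroup E] [InnerProductSpace ℝ E] (e : E) (s : ℝ)
    (x : E) : Filter.Tendsto (fun δ => cutoff e s δ x) (nhdsWithin 0 (Set.Ioi 0))
      (nhds ((halfSpace e s).indicator 1 x)) := by
  refine tendsto_const_nhds.congr' ?_
  by_cases hx : x ∈ halfSpace e s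
  · filter_upwards [Ioo_mem_nhdsGT (sub_pos.2 hx)] with δ hδ
    rw [Set.indicator_of_mem hx, Pi.one_apply, cutoff_eq_one hδ.1 (by linarith [hδ.2])]
  · filter_upwards [self_mem_nhdsWithin] with δ hδ
    rw [Set.indicator_of_notMem hx, cutoff_eq_zero hδ hx]

lemma tendsto_setIntegral_interpolate_cutoff (e : Euc d) (s : ℝ) {p q : Euc d → ℝ}
    (hp : IntegrableOn p A) (hq : IntegrableOn q A) :
    Filter.Tendsto (fun δ => ∫ x in A, ((1 - cutoff e s δ x) * p x + cutoff e s δ x * q x))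
      (nhdsWithin 0 (Set.Ioi 0))
      (nhds ((∫ x in A \ halfSpace e s, p x) + ∫ x in A ∩ halfSpace e s, q x)) := by
  have hm := measurableSet_halfSpace e s
  have hvalue : (∫ x in A \ halfSpace e s, p x) + ∫ x in A ∩ halfSpace e s, q x =
      ∫ x in A, ((1 - (halfSpace e s).indicator 1 x) * p x +
        (halfSpace e s).indicator 1 x * q x) := by
    rw [Set.sdiff_eq, ← setIntegral_indicator hm.compl, ← setIntegral_indicator hm,
      ← integral_add (hp.indicator hm.compl) (hq.indicator hm)]
    congr 1 with x
    by_cases hx : x ∈ halfSpace e s <;> simp [hx]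
  rw [hvalue]
  refine tendsto_integral_filter_of_dominated_convergence (fun x => |p x| + |q x|)
    (Filter.Eventually.of_forall fun δ => ?_)
    (Filter.Eventually.of_forall fun δ => Filter.Eventually.of_forall fun x => ?_)
    (hp.abs.add hq.abs) (Filter.Eventually.of_forall fun x =>
      (((tendsto_cutoff e s x).const_sub 1).mul_const _).add ((tendsto_cutoff e s x).mul_const _))
  · have hη := (contDiff_cutoff e s δ).continuous
    exact ((continuous_const.sub hη).aestronglyMeasurable.mul hp.1).add
      (hη.aestronglyMeasurable.mul hq.1)
  · have hη0 := cutoff_nonneg e s δ x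
    have hη1 := cutoff_le_one e s δ x
    refine (norm_add_le _ _).trans (add_le_add ?_ ?_)
    · rw [norm_mul, Real.norm_of_nonneg (sub_nonneg.2 hη1)]
      exact mul_le_of_le_one_left (norm_nonneg _) (sub_le_self 1 hη0)
    · rw [norm_mul, Real.norm_of_nonneg hη0]
      exact mul_le_of_le_one_left (norm_nonneg _) hη1

/-- Admissible fields `X` for `A \ H` and `Y` for `A ∩ H` are glued by a cutoff across `∂H`; the
gluing error is supported in a slab, whose volume is controlled by the hypothesis `hc`. -/
lemma perimeter_sdiff_add_perimeter_inter_le (hA : volume A < ⊤) (hP : perimeter A < ⊤)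
    {e : Euc d} (he : ‖e‖ ≤ 1) {s c a : ℝ} (ha : 0 < a)
    (hc : ∀ δ, 0 < δ → δ < a →
      volume.real (A ∩ halfSpace e s) - volume.real (A ∩ halfSpace e (s + δ)) ≤ c * δ) :
    perimeter (A \ halfSpace e s) + perimeter (A ∩ halfSpace e s) ≤
      ENNReal.ofReal ((perimeter A).toReal + transitionBound * 2 * c) := by
  refine perimeter_add_perimeter_le_ofReal fun X Y hX hY =>
    le_of_tendsto (tendsto_setIntegral_interpolate_cutoff e s
      (integrable_divergence hX.contDiff hX.hasCompactSupport).integrableOn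
      (integrable_divergence hY.contDiff hY.hasCompactSupport).integrableOn) ?_
  filter_upwards [Ioo_mem_nhdsGT ha] with δ hδ
  exact setIntegral_interpolate_divergence_le hA hP he hδ.1 (hc δ hδ.1 hδ.2) hX hY

end PerimeterSplit

section HalfSpaceCuts

variable {d : ℕ} {A : Set (Euc d)} {e : Euc d}

lemma antitone_measureReal_inter_halfSpace (hA : volume A < ⊤) (e : Euc d) :
    Antitone fun t => volume.real (A ∩ halfSpace e t) := fun _ _ hst =>
  measureReal_mono (Set.inter_subset_inter_right _ (antitone_halfSpace e hst))
    ((measure_mono Set.inter_subset_left).trans_lt hA).ne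

lemma eventually_mem_halfSpace_iff {E : Type*} [NormedAddCommGroup E] [InnerProductSpace ℝ E]
    (e x : E) (s : ℝ) :
    ∀ᶠ t in nhdsWithin s (Set.Ioi s), x ∈ halfSpace e t ↔ x ∈ halfSpace e s := by
  by_cases hx : x ∈ halfSpace e s
  · filter_upwards [Ioo_mem_nhdsGT (mem_halfSpace.1 hx)] with t ht
    exact iff_of_true (mem_halfSpace.2 ht.2) hx
  · filter_upwards [self_mem_nhdsWithin] with t ht
    exact iff_of_false (fun hxt => hx (antitone_halfSpace e (le_of_lt ht) hxt)) hx

lemma lowerSemicontinuous_measureReal_inter_halfSpace (hA : volume A < ⊤) (e : Euc d) :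
    LowerSemicontinuous fun t => volume.real (A ∩ halfSpace e t) := by
  intro s y hy
  have : IsFiniteMeasure (volume.restrict A) := isFiniteMeasure_restrict.2 hA.ne
  have hright := (ENNReal.tendsto_toReal (measure_ne_top _ _)).comp
    (tendsto_measure_of_tendsto_indicator_of_isFiniteMeasure (nhdsWithin s (Set.Ioi s))
      (volume.restrict A) (measurableSet_halfSpace e) (eventually_mem_halfSpace_iff e · s))
  simp only [Function.comp_def, Measure.restrict_apply (measurableSet_halfSpace e _),
    Set.inter_comm _ A] at hright
  obtain ⟨t, hyt, hst⟩ := ((hright.eventually (lt_mem_nhds hy)).and self_mem_nhdsWithin).exists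
  filter_upwards [Iio_mem_nhds (show s < t from hst)] with u hut
  exact hyt.trans_le (antitone_measureReal_inter_halfSpace hA e (le_of_lt hut))

/-- The function `s ↦ V s + (V t / δ) * s` is at least as large at `t + δ` as at `t`, so it attains
its minimum over `[t, t + δ]` in `[t, t + δ)`. -/
lemma exists_slope_le {V : ℝ → ℝ} (hlsc : LowerSemicontinuous V) (hV : ∀ t, 0 ≤ V t) (t : ℝ)
    {δ : ℝ} (hδ : 0 < δ) :
    ∃ s ∈ Set.Ico t (t + δ), ∀ h, 0 < h → h < t + δ - s → V s - V (s + h) ≤ V t / δ * h := by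
  let F : ℝ → ℝ := fun s => V s + V t / δ * s
  have hF : LowerSemicontinuousOn F (Set.Icc t (t + δ)) :=
    (hlsc.add (continuous_const.mul continuous_id).lowerSemicontinuous).lowerSemicontinuousOn _
  obtain ⟨m, hm, hmin⟩ := hF.exists_isMinOn (Set.nonempty_Icc.2 (by linarith)) isCompact_Icc
  have hends : F t ≤ F (t + δ) := by
    have hslope : V t / δ * (t + δ) = V t / δ * t + V t := by field_simp
    simp only [F, hslope]
    linarith [hV (t + δ)]
  obtain ⟨s, hs, hsmin⟩ : ∃ s ∈ Set.Ico t (t + δ), ∀ z ∈ Set.Icc t (t + δ), F s ≤ F z := by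
    rcases hm.2.lt_or_eq with hlt | rfl
    · exact ⟨m, ⟨hm.1, hlt⟩, fun z hz => hmin hz⟩
    · exact ⟨t, ⟨le_rfl, by linarith⟩, fun z hz => hends.trans (hmin hz)⟩
  refine ⟨s, hs, fun h h0 h1 => ?_⟩
  have hsh : F s ≤ F (s + h) := hsmin (s + h) ⟨by linarith [hs.1], by linarith⟩
  simp only [F] at hsh
  linarith

lemma exists_perimeter_inter_halfSpace_le (hA : volume A < ⊤) (hP : perimeter A < ⊤)
    (he : ‖e‖ ≤ 1) {t δ b : ℝ} (hδ : 0 < δ)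
    (hcut : ∀ s, t ≤ s → perimeter (A \ halfSpace e s) < ⊤ →
      (perimeter A).toReal - (perimeter (A \ halfSpace e s)).toReal ≤ b) :
    ∃ s ∈ Set.Ico t (t + δ), perimeter (A ∩ halfSpace e s) < ⊤ ∧
      (perimeter (A ∩ halfSpace e s)).toReal ≤
        b + transitionBound * 2 * (volume.real (A ∩ halfSpace e t) / δ) := by
  obtain ⟨s, hs, hslope⟩ := exists_slope_le (lowerSemicontinuous_measureReal_inter_halfSpace hA e)
    (fun _ => measureReal_nonneg) t hδ
  have hsplit := perimeter_sdiff_add_perimeter_inter_le hA hP he (sub_pos.2 hs.2) hslope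
  obtain ⟨hU, hV⟩ := ENNReal.add_lt_top.1 (hsplit.trans_lt ENNReal.ofReal_lt_top)
  have hbound := transitionBound_nonneg
  have hsum := ENNReal.toReal_le_of_le_ofReal (by positivity) hsplit
  rw [ENNReal.toReal_add hU.ne hV.ne] at hsum
  exact ⟨s, hs, hV, by linarith [hcut s hs.1 hU]⟩

lemma measureReal_inter_halfSpace_le (hA : NullMeasurableSet A volume) (hA' : volume A < ⊤)
    (hP : perimeter A < ⊤) (he : ‖e‖ ≤ 1) {t δ b r : ℝ} (hδ : 0 < δ)
    (hcut : ∀ s, t ≤ s → perimeter (A \ halfSpace e s) < ⊤ →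
      (perimeter A).toReal - (perimeter (A \ halfSpace e s)).toReal ≤ b) (hr : 0 < r)
    (hball : 2 * volume.real (A ∩ halfSpace e t) ≤ volume.real (ball (0 : Euc d) r)) :
    volume.real (A ∩ halfSpace e (t + δ)) ≤
      2 * r * (b + transitionBound * 2 * (volume.real (A ∩ halfSpace e t) / δ)) := by
  obtain ⟨s, hs, hPs, hPs_le⟩ := exists_perimeter_inter_halfSpace_le hA' hP he hδ hcut
  have hanti := antitone_measureReal_inter_halfSpace hA' e
  have hts : volume.real (A ∩ halfSpace e s) ≤ volume.real (A ∩ halfSpace e t) := hanti hs.1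
  calc volume.real (A ∩ halfSpace e (t + δ)) ≤ volume.real (A ∩ halfSpace e s) := hanti hs.2.le
    _ ≤ 2 * r * (perimeter (A ∩ halfSpace e s)).toReal :=
        measureReal_le_mul_perimeter (hA.inter (measurableSet_halfSpace e s).nullMeasurableSet)
          ((measure_mono Set.inter_subset_left).trans_lt hA') hPs hr (by linarith)
    _ ≤ _ := by gcongr

end HalfSpaceCuts

section Iteration

variable {d : ℕ} {A : Set (Euc d)} {w : Euc d → ℝ} {g : Euc d → Euc d} {e : Euc d} {ε k R : ℝ}

/-- The comparison property that defines an energy subsolution, with given constants. -/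
def IsSubsolutionWith (A : Set (Euc d)) (ε k : ℝ) : Prop :=
  ∀ U : Set (Euc d), U ⊆ A → NullMeasurableSet U volume →
    ∀ wA wU : Euc d → ℝ, IsTorsionFunction A wA → IsTorsionFunction U wU →
      eLpNorm (fun x => wA x - wU x) 2 volume ≤ ENNReal.ofReal ε →
      perimeter U < ⊤ →
      energy A + k * (perimeter A).toReal ≤ energy U + k * (perimeter U).toReal

lemma IsSubsolutionWith.mul_perimeter_sub_le [NeZero d] (hsub : IsSubsolutionWith A ε k)
    (hA : NullMeasurableSet A volume) (hA' : volume A < ⊤) (hε : 0 ≤ ε)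
    (hw : IsTorsionPair A w g) (he : ‖e‖ ≤ 1) (hR : 0 < R)
    (hRball : 2 * volume.real A ≤ volume.real (ball (0 : Euc d) R)) {s t δ : ℝ}
    (hclose : R ^ 2 * (caccioppoliConst * tailMass A w e (t - 1)) ≤ ε ^ 2)
    (hδ : 0 < δ) (hδ1 : δ ≤ 1) (hts : t + δ ≤ s) (hP : perimeter (A \ halfSpace e s) < ⊤) :
    k * ((perimeter A).toReal - (perimeter (A \ halfSpace e s)).toReal) ≤
      1 / 2 * (caccioppoliConst / δ ^ 2 * tailMass A w e t) := by
  have hU : NullMeasurableSet (A \ halfSpace e s) volume :=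
    hA.diff (measurableSet_halfSpace e _).nullMeasurableSet
  obtain ⟨wU, gU, hwU⟩ := exists_isTorsionPair hU ((measure_mono Set.sdiff_subset).trans_lt hA')
  have henergy_close := hw.energy_sdiff_halfSpace_sub_le hA hA' he (s := s) (t := t - 1)
    one_pos le_rfl (by linarith) hwU
  have hsq : ∫ x, (w x - wU x) ^ 2 ≤ ε ^ 2 :=
    calc ∫ x, (w x - wU x) ^ 2 ≤ 2 * R ^ 2 * (energy (A \ halfSpace e s) - energy A) :=
          hw.integral_sub_sq_le hA hA' hU Set.sdiff_subset hwU hR hRball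
      _ ≤ 2 * R ^ 2 * (1 / 2 * (caccioppoliConst / 1 ^ 2 * tailMass A w e (t - 1))) := by gcongr
      _ = R ^ 2 * (caccioppoliConst * tailMass A w e (t - 1)) := by ring
      _ ≤ ε ^ 2 := hclose
  have hcompare := hsub _ Set.sdiff_subset hU w wU hw.isTorsionFunction hwU.isTorsionFunction
    (eLpNorm_two_le_of_integral_sq_le
      (hw.isSobolevLike.isH1.memLp.sub hwU.isSobolevLike.isH1.memLp) hε hsq) hP
  linarith [hw.energy_sdiff_halfSpace_sub_le hA hA' he hδ hδ1 hts hwU]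

/-- The constant in the decay estimate for the tail mass. -/
noncomputable def decayConst (k : ℝ) : ℝ :=
  caccioppoliConst / k + 4 * transitionBound + caccioppoliConst

lemma decayConst_pos (hk : 0 < k) : 0 < decayConst k := by
  have hcacc := caccioppoliConst_pos
  have hbound := transitionBound_nonneg
  unfold decayConst
  positivity

lemma tailMass_decay [NeZero d] (hsub : IsSubsolutionWith A ε k) (hA : NullMeasurableSet A volume)
    (hA' : volume A < ⊤) (hP : perimeter A < ⊤) (hε : 0 ≤ ε) (hk : 0 < k)
    (hw : IsTorsionPair A w g) (he : ‖e‖ ≤ 1) (hR : 0 < R)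
    (hRball : 2 * volume.real A ≤ volume.real (ball (0 : Euc d) R)) {t δ r : ℝ}
    (hclose : R ^ 2 * (caccioppoliConst * tailMass A w e (t - 1)) ≤ ε ^ 2)
    (hδ : 0 < δ) (hδ1 : δ ≤ 1) (hr : 0 < r) (hr1 : r ≤ 1)
    (hball : 2 * tailMass A w e t ≤ volume.real (ball (0 : Euc d) r)) :
    tailMass A w e (t + 2 * δ) ≤ decayConst k * r / δ ^ 2 * tailMass A w e t := by
  have hw2 := hw.isSobolevLike.isH1.memLp
  have hVt := measureReal_le_tailMass hA' hw2 e t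
  have hVδ : volume.real (A ∩ halfSpace e (t + δ)) ≤ tailMass A w e t :=
    (antitone_measureReal_inter_halfSpace hA' e (by linarith)).trans hVt
  have hY := tailMass_nonneg A w e t
  have hcacc := caccioppoliConst_pos
  have hbound := transitionBound_nonneg
  have hδsq : δ ^ 2 ≤ δ := pow_le_of_le_one hδ.le hδ1 two_ne_zero
  have hrsq : r ^ 2 ≤ r := pow_le_of_le_one hr.le hr1 two_ne_zero
  have hcut (s : ℝ) (hs : t + δ ≤ s) (hPs : perimeter (A \ halfSpace e s) < ⊤) :
      (perimeter A).toReal - (perimeter (A \ halfSpace e s)).toReal ≤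
        1 / 2 * (caccioppoliConst / δ ^ 2 * tailMass A w e t) / k :=
    (le_div_iff₀' hk).2
      (hsub.mul_perimeter_sub_le hA hA' hε hw he hR hRball hclose hδ hδ1 hs hPs)
  have hvolume : volume.real (A ∩ halfSpace e (t + 2 * δ)) ≤
      (caccioppoliConst / k + 4 * transitionBound) * r / δ ^ 2 * tailMass A w e t := by
    rw [two_mul, ← add_assoc]
    calc volume.real (A ∩ halfSpace e (t + δ + δ))
        ≤ 2 * r * (1 / 2 * (caccioppoliConst / δ ^ 2 * tailMass A w e t) / k +
            transitionBound * 2 * (volume.real (A ∩ halfSpace e (t + δ)) / δ)) :=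
          measureReal_inter_halfSpace_le hA hA' hP he hδ hcut hr (by linarith)
      _ ≤ 2 * r * (1 / 2 * (caccioppoliConst / δ ^ 2 * tailMass A w e t) / k +
            transitionBound * 2 * (tailMass A w e t / δ ^ 2)) := by gcongr
      _ = _ := by ring
  have hmass : ∫ x in A ∩ halfSpace e (t + 2 * δ), w x ^ 2 ≤
      caccioppoliConst * r / δ ^ 2 * tailMass A w e t :=
    calc ∫ x in A ∩ halfSpace e (t + 2 * δ), w x ^ 2
        ≤ r ^ 2 * (caccioppoliConst / δ ^ 2 * tailMass A w e t) :=
          hw.setIntegral_inter_halfSpace_sq_le hA hA' he hδ hδ1 (by linarith) hr (by linarith)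
      _ ≤ r * (caccioppoliConst / δ ^ 2 * tailMass A w e t) := by gcongr
      _ = _ := by ring
  calc tailMass A w e (t + 2 * δ)
      ≤ (caccioppoliConst / k + 4 * transitionBound) * r / δ ^ 2 * tailMass A w e t +
          caccioppoliConst * r / δ ^ 2 * tailMass A w e t := by
        rw [tailMass_eq_add hA' hw2]
        exact add_le_add hvolume hmass
    _ = decayConst k * r / δ ^ 2 * tailMass A w e t := by unfold decayConst; ring

lemma two_mul_le_of_geometric_step {y : ℕ → ℝ} {c q ρ : ℝ} {m : ℕ} (hq : 0 ≤ q)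
    (h0 : 2 * y 0 ≤ ρ ^ m * c)
    (hstep : ∀ n, 2 * y n ≤ (ρ * q ^ n) ^ m * c → y (n + 1) ≤ q ^ m * y n) (n : ℕ) :
    2 * y n ≤ (ρ * q ^ n) ^ m * c := by
  induction n with
  | zero => simpa using h0
  | succ n ih =>
    calc 2 * y (n + 1) ≤ q ^ m * (2 * y n) := by linarith [hstep n ih]
      _ ≤ q ^ m * ((ρ * q ^ n) ^ m * c) := by gcongr
      _ = (ρ * q ^ (n + 1)) ^ m * c := by ring

/-- The step sizes `(1/2)^n` sum to a finite length, while the radii `ρ (1/4)^n` compensate the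
factors `δ⁻² = 4^n`, so that every step gains the fixed factor `(1/4)^m`. -/
lemma exists_eq_zero_of_decay {Y : ℝ → ℝ} {m : ℕ} (hm : m ≠ 0) (hanti : Antitone Y)
    (hY : ∀ t, 0 ≤ Y t) (hlim : Filter.Tendsto Y Filter.atTop (nhds 0)) {c K T₀ : ℝ}
    (hc : 0 < c) (hK : 0 < K)
    (hstep : ∀ t δ r, T₀ ≤ t → 0 < δ → δ ≤ 1 → 0 < r → r ≤ 1 → 2 * Y t ≤ r ^ m * c →
      Y (t + 2 * δ) ≤ K * r / δ ^ 2 * Y t) : ∃ T, Y T = 0 := by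
  obtain ⟨ρ, hρ, hρ1, hKρ⟩ : ∃ ρ : ℝ, 0 < ρ ∧ ρ ≤ 1 ∧ K * ρ ≤ (1 / 4) ^ m :=
    ⟨min 1 ((1 / 4) ^ m / K), by positivity, min_le_left _ _,
      (le_div_iff₀' hK).1 (min_le_right _ _)⟩
  obtain ⟨T, hT, hT₀⟩ := ((hlim.eventually (gt_mem_nhds (show 0 < ρ ^ m * c / 2 by positivity))).and
    (Filter.eventually_ge_atTop T₀)).exists
  have hhalf (n : ℕ) : (0 : ℝ) < (1 / 2) ^ n ∧ ((1 : ℝ) / 2) ^ n ≤ 1 :=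
    ⟨by positivity, pow_le_one₀ (by norm_num) (by norm_num)⟩
  have hquarter (n : ℕ) : (0 : ℝ) < (1 / 4) ^ n ∧ ((1 : ℝ) / 4) ^ n ≤ 1 :=
    ⟨by positivity, pow_le_one₀ (by norm_num) (by norm_num)⟩
  let t : ℕ → ℝ := fun n => T + 4 * (1 - (1 / 2) ^ n)
  have hdecay (n : ℕ) : 2 * Y (t n) ≤ (ρ * (1 / 4) ^ n) ^ m * c := by
    refine two_mul_le_of_geometric_step (y := fun n => Y (t n)) (by norm_num)
      (by simp only [t]; norm_num; linarith) (fun n hn => ?_) n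
    have hnext : t (n + 1) = t n + 2 * (1 / 2) ^ n := by simp only [t, pow_succ]; ring
    have hsq : (((1 : ℝ) / 2) ^ n) ^ 2 = (1 / 4) ^ n := by rw [pow_right_comm]; norm_num
    have hY_next := hstep (t n) ((1 / 2) ^ n) (ρ * (1 / 4) ^ n)
      (by simp only [t]; linarith [(hhalf n).2]) (hhalf n).1 (hhalf n).2
      (mul_pos hρ (hquarter n).1) (mul_le_one₀ hρ1 (hquarter n).1.le (hquarter n).2) hn
    rw [← hnext, hsq, ← mul_assoc, mul_div_cancel_right₀ _ (hquarter n).1.ne'] at hY_next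
    exact hY_next.trans (mul_le_mul_of_nonneg_right hKρ (hY _))
  have hbound_lim : Filter.Tendsto (fun n : ℕ => (ρ * (1 / 4 : ℝ) ^ n) ^ m * c) Filter.atTop
      (nhds ((ρ * 0) ^ m * c)) :=
    (((tendsto_pow_atTop_nhds_zero_of_lt_one (by norm_num) (by norm_num)).const_mul ρ).pow
      m).mul_const c
  rw [mul_zero, zero_pow hm, zero_mul] at hbound_lim
  have hlimit : 2 * Y (T + 4) ≤ 0 := ge_of_tendsto' hbound_lim fun n => by
    have htn : t n ≤ T + 4 := by simp only [t]; linarith [(hhalf n).1]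
    linarith [hanti htn, hdecay n]
  exact ⟨T + 4, by linarith [hY (T + 4)]⟩

theorem IsEnergySubsolution.exists_volume_inter_halfSpace_eq_zero [NeZero d]
    (h : IsEnergySubsolution A) (he : ‖e‖ ≤ 1) : ∃ T : ℝ, volume (A ∩ halfSpace e T) = 0 := by
  obtain ⟨hA, hA', hP, ε, hε, k, hk, hsub⟩ := h
  obtain ⟨w, g, hw⟩ := exists_isTorsionPair hA hA'
  obtain ⟨R, hR, hRball⟩ := exists_le_measureReal_ball (E := Euc d) volume (2 * volume.real A)
  have hw2 := hw.isSobolevLike.isH1.memLp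
  have hlim := tendsto_tailMass_atTop hA' hw2 e
  obtain ⟨T₀, hT₀⟩ : ∃ T₀, ∀ t, T₀ ≤ t →
      R ^ 2 * (caccioppoliConst * tailMass A w e (t - 1)) ≤ ε ^ 2 := by
    have hclose := (((hlim.comp (Filter.tendsto_atTop_add_const_right _ (-1) Filter.tendsto_id)
      ).const_mul caccioppoliConst).const_mul (R ^ 2))
    rw [mul_zero, mul_zero] at hclose
    exact Filter.eventually_atTop.1 (hclose.eventually (ge_mem_nhds (pow_pos hε 2)))
  have hω : 0 < volume.real (ball (0 : Euc d) 1) :=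
    ENNReal.toReal_pos (measure_ball_pos _ _ one_pos).ne' measure_ball_lt_top.ne
  obtain ⟨T, hT⟩ := exists_eq_zero_of_decay (T₀ := T₀) (NeZero.ne d)
    (antitone_tailMass hA' hw2 e) (tailMass_nonneg A w e) hlim hω (decayConst_pos hk)
    fun t δ r ht hδ hδ1 hr hr1 hball =>
      tailMass_decay hsub hA hA' hP hε.le hk hw he hR hRball (hT₀ t ht) hδ hδ1 hr hr1 <| by
        rwa [measureReal_ball volume hr.le, finrank_euclideanSpace_fin]
  refine ⟨T, (measureReal_eq_zero_iff ((measure_mono Set.inter_subset_left).trans_lt hA').ne).1 ?_⟩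
  exact le_antisymm ((measureReal_le_tailMass hA' hw2 e T).trans hT.le) measureReal_nonneg

end Iteration

section CoordinateHalfSpaces

variable {d : ℕ}

lemma norm_le_sum_abs (x : Euc d) : ‖x‖ ≤ ∑ i, |x i| := by
  conv_lhs => rw [← (EuclideanSpace.basisFun (Fin d) ℝ).sum_repr x]
  refine (norm_sum_le _ _).trans (Finset.sum_le_sum fun i _ => ?_)
  simp [norm_smul]

lemma sdiff_ball_subset_iUnion_halfSpace (A : Set (Euc d)) (T T' : Fin d → ℝ) :
    A \ ball 0 ((∑ i, max (T i) (T' i)) + 1) ⊆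
      ⋃ i, A ∩ halfSpace (EuclideanSpace.single i 1) (T i) ∪
        A ∩ halfSpace (-EuclideanSpace.single i 1) (T' i) := by
  rintro x ⟨hxA, hxball⟩
  by_contra hx
  simp only [Set.mem_iUnion, Set.mem_union, Set.mem_inter_iff, hxA, true_and, mem_halfSpace,
    not_or, not_exists, not_lt, inner_neg_left, EuclideanSpace.inner_single_left, map_one,
    one_mul] at hx
  refine hxball (mem_ball_zero_iff.2 (lt_add_of_le_of_pos ?_ one_pos))
  exact (norm_le_sum_abs x).trans (Finset.sum_le_sum fun i _ => abs_le'.2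
    ⟨(hx i).1.trans (le_max_left _ _), (hx i).2.trans (le_max_right _ _)⟩)

end CoordinateHalfSpaces

theorem lemma3 {d : ℕ} (Ω : Set (Euc d)) (hΩ : IsEnergySubsolution Ω) :
    ∃ R : ℝ, volume (Ω \ ball (0 : Euc d) R) = 0 := by
  rcases eq_or_ne d 0 with rfl | hd
  · refine ⟨1, ?_⟩
    rw [Set.sdiff_eq_empty.2 fun x _ => by simp [Subsingleton.elim x 0], measure_empty]
  have : NeZero d := ⟨hd⟩
  have hhalf (e : Euc d) (he : ‖e‖ = 1) : ∃ T : ℝ, volume (Ω ∩ halfSpace e T) = 0 :=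
    hΩ.exists_volume_inter_halfSpace_eq_zero he.le
  choose T hT using fun i : Fin d => hhalf (EuclideanSpace.single i 1) (by simp)
  choose T' hT' using fun i : Fin d => hhalf (-EuclideanSpace.single i 1) (by simp)
  exact ⟨_, measure_mono_null (sdiff_ball_subset_iUnion_halfSpace Ω T T')
    (measure_iUnion_null fun i => measure_union_null (hT i) (hT' i))⟩
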